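/- **Setting.** Let $M$ be a connected smooth $n$-dimensional manifold with tangent bundle $\pi:TM\to M$. Let $U\subset TM\setminus\{0\}$ be a conic sub-bundle, i.e. a $2n$-dimensional submanifold (open, or with boundary) of the slit tangent bundle such that $\pi(U)=M$ and $\lambda u\in U$ whenever $u\in U$, $\lambda\neq 0$. Let $U$ be time oriented: $U=U^+\cup U^-$ is a disjoint union, $u\in U^+$ if and only if $-u\in U^-$, and the function equal to $1$ on $U^+$ and $-1$ on $U^-$ is smooth on $U$. For $h\in C^\infty(M)$ write $\dot h(u)=u\langle h\rangle$ for $u\in TM$. Let $\mathcal R$ be the radial vector field, $\mathcal R|_u=\frac{d}{dt}\big|_{t=1}(tu)$. A *kinematic domain* is a connected $(2n-1)$-dimensional submanifold $\Sigma_E:E\hookrightarrow U$ with $E\subset U^+$ and $\pi(E)=M$ such that every $u\in U$ is $u=\lambda v$ for a unique pair $v\in E$, $\lambda\neq0$, and such that $E$ is a hypersurface of $U$ transverse to $\mathcal R$: near each of its points $E$ is the zero set in $U$ of a smooth function $F$ with $\mathcal R\langle F\rangle\ne0$ at that point. A *Vlasov field on $E$* is a smooth vector field $W_E$ on $E$ with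 $\pi_*(W_E|_v)=v$. A *Vlasov field on $U$* is a smooth vector field $W$ on $U$ with $\pi_*(W|_u)=u$ and $W\langle\dot h\rangle|_{\lambda u}=\lambda^2W\langle\dot h\rangle|_u$ for all $h\in C^\infty(M)$, $u\in U$, $\lambda>0$; it is an *extension* of $W_E$ if $\Sigma_{E*}(W_E|_v)=W|_{\Sigma_E(v)}$ for all $v\in E$. **Lemma.** Let $E$ be a kinematic domain, $W_E$ a Vlasov field on $E$ and $\theta_E$ a smooth $(2n-2)$-form on $E$ satisfying the transport equations on $E$, $d\theta_E=0$ and $i_{W_E}\theta_E=0$. Let $\Pi:U^+\to E$ be the radial projection, $\Pi(\lambda v)=v$ for $v\in E$, $\lambda>0$. Let $\theta$ be the future-pointing form on $U$ given by $\theta|_{U^+}=\Pi^*\theta_E$ and $\theta|_{U^-}=0$. Let the Vlasov field $W$ on $U$ be an extension of $W_E$, and put $\Psi=\mathcal R\wedge W$. Then $\theta$ is a smooth $(2n-2)$-form on $U$, $\Psi$ is a Vlasov bivector (a simple smooth bivector field of the form $\mathcal R\wedge W'$ with $W'$ a Vlasov field on $U$), and $(\Psi,\theta)$ satisfies the transport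 equations on $U$: $d\theta=0$, and $\mathrm{Null}(\Psi,\theta)$ holds, that is, $i_X\theta=0$ and $i_Y\theta=0$ for all smooth vector fields $X,Y$ on $U$ with $\Psi=X\wedge Y$ (in particular $i_{\mathcal R}\theta=0$ and $i_W\theta=0$). -/

import Mathlib

open Set Topology Manifold
open scoped ContDiff

namespace Vlasov

noncomputable section

section Forms

variable {G : Type*} [NormedAddCommGroup G] [NormedSpace ℝ G]
  {H : Type*} [TopologicalSpace H] (J : ModelWithCorners ℝ G H)
  {N : Type*} [TopologicalSpace N] [ChartedSpace H N]

/-- A (not necessarily smooth) vector field on the manifold `N`. -/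
abbrev VField (_J : ModelWithCorners ℝ G H) (N : Type*) [TopologicalSpace N] [ChartedSpace H N] :
    Type _ :=
  ∀ x : N, TangentSpace _J x

/-- A (not necessarily smooth) differential form of degree `k` on the manifold `N`. -/
abbrev DForm (_J : ModelWithCorners ℝ G H) (N : Type*) [TopologicalSpace N] [ChartedSpace H N]
    (k : ℕ) : Type _ :=
  ∀ x : N, TangentSpace _J x [⋀^Fin k]→L[ℝ] ℝ

/-- The vector field `X` is smooth on the set `S`. -/
def SmoothField [IsManifold J 1 N] (S : Set N) (X : VField J N) : Prop :=
  ContMDiffOn J J.tangent ∞ (fun x => (⟨x, X x⟩ : TangentBundle J N)) S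

/-- The coordinate expression of the form `α` in the preferred chart `φ` at `x₀`: the pullback
`(φ⁻¹)^* α`, a form on the model vector space. -/
def coordForm {k : ℕ} (α : DForm J N k) (x₀ : N) (y : G) : G [⋀^Fin k]→L[ℝ] ℝ :=
  (α ((extChartAt J x₀).symm y)).compContinuousLinearMap
    (mfderivWithin 𝓘(ℝ, G) J (extChartAt J x₀).symm (range J) y)

/-- The form `α` is smooth on the set `S`: its coordinate expressions are smooth. -/
def SmoothForm {k : ℕ} (S : Set N) (α : DForm J N k) : Prop :=
  ∀ x₀ : N, ContDiffOn ℝ ∞ (coordForm J α x₀)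
    ((extChartAt J x₀).target ∩ (extChartAt J x₀).symm ⁻¹' S)

/-- The exterior derivative at `x` of the form `α` on the subset `S` of `N`, computed in
the preferred chart at `x`. It is used for open sets and for full-dimensional subsets with boundary;
at boundary points the derivative is taken within the set. -/
def extD {k : ℕ} (S : Set N) (α : DForm J N k) : DForm J N (k + 1) := fun x =>
  (extDerivWithin (coordForm J α x) ((extChartAt J x).symm ⁻¹' S ∩ range J)
    (extChartAt J x x)).compContinuousLinearMap (mfderiv J 𝓘(ℝ, G) (extChartAt J x) x)

end Forms

/-- The interior product `i_X α`; it vanishes on forms of degree zero. -/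
def interiorProd {V : Type*} [AddCommGroup V] [Module ℝ V] [TopologicalSpace V] (X : V) :
    {k : ℕ} → (α : V [⋀^Fin k]→L[ℝ] ℝ) → V [⋀^Fin (k - 1)]→ₗ[ℝ] ℝ
  | 0, _ => 0
  | _ + 1, α => α.toAlternatingMap.curryLeft X

section Conic

variable {n : ℕ} {M : Type*} [TopologicalSpace M] [ChartedSpace (EuclideanSpace ℝ (Fin n)) M]

/-- Fibrewise multiplication by `t` on the tangent bundle. -/
def scale (t : ℝ) (u : TangentBundle (𝓡 n) M) : TangentBundle (𝓡 n) M := ⟨u.proj, t • u.snd⟩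

/-- The scalar lift `ḣ(u) = u⟨h⟩` of a function `h` on `M`. -/
def scalarLift (h : M → ℝ) (u : TangentBundle (𝓡 n) M) : ℝ :=
  mfderiv (𝓡 n) 𝓘(ℝ, ℝ) h u.proj u.snd

variable [IsManifold (𝓡 n) ∞ M]

/-- The radial vector field: its value at `u` is the velocity at `t = 1` of `t ↦ t u`. -/
def radialField : VField (𝓡 n).tangent (TangentBundle (𝓡 n) M) := fun u =>
  mfderiv 𝓘(ℝ, ℝ) (𝓡 n).tangent (fun t : ℝ => scale t u) 1 (1 : ℝ)

/-- The derivative `X⟨F⟩` of the function `F` on `TM` along the vector `X` at `u`. -/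
def dirDeriv (F : TangentBundle (𝓡 n) M → ℝ) (u : TangentBundle (𝓡 n) M)
    (X : TangentSpace (𝓡 n).tangent u) : ℝ :=
  mfderiv (𝓡 n).tangent 𝓘(ℝ, ℝ) F u X

/-- A conic sub-bundle of the slit tangent bundle. The two regularity conditions hold for open
sets and for full-dimensional submanifolds with boundary; under them the tangent space of `U`
at each of its points is the whole tangent space of `TM`. -/
structure IsConicSubbundle (U : Set (TangentBundle (𝓡 n) M)) : Prop where
  slit : ∀ u ∈ U, u.snd ≠ 0
  proj_surj : ∀ p : M, ∃ u ∈ U, u.proj = p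
  conic : ∀ u ∈ U, ∀ t : ℝ, t ≠ 0 → scale t u ∈ U
  uniqueDiff : UniqueMDiffOn (𝓡 n).tangent U
  subset_closure_interior : U ⊆ closure (interior U)

open Classical in
/-- The causal indicator: `1` on future pointing vectors and `-1` on the others. -/
def causalIndicator (Up : Set (TangentBundle (𝓡 n) M)) (u : TangentBundle (𝓡 n) M) : ℝ :=
  if u ∈ Up then 1 else -1

/-- A time orientation `U = U⁺ ∪ U⁻`; the causal indicator is a scalar field,
that is, a smooth function, on `U`. -/
structure IsTimeOrientation (U Up Um : Set (TangentBundle (𝓡 n) M)) : Prop where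
  union_eq : U = Up ∪ Um
  disj : Disjoint Up Um
  neg_iff : ∀ u, u ∈ Up ↔ scale (-1) u ∈ Um
  smooth_indicator : ContMDiffOn (𝓡 n).tangent 𝓘(ℝ, ℝ) ∞ (causalIndicator Up) U

/-- A Vlasov field on `U`: smooth, horizontal and radially quadratic. -/
structure IsVlasovField (U : Set (TangentBundle (𝓡 n) M))
    (W : VField (𝓡 n).tangent (TangentBundle (𝓡 n) M)) : Prop where
  smooth : SmoothField (𝓡 n).tangent U W
  horizontal : ∀ u ∈ U,
    mfderiv (𝓡 n).tangent (𝓡 n) (Bundle.TotalSpace.proj : TangentBundle (𝓡 n) M → M) u (W u)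
      = u.snd
  quadratic : ∀ h : M → ℝ, ContMDiff (𝓡 n) 𝓘(ℝ, ℝ) ∞ h → ∀ u ∈ U, ∀ t : ℝ, 0 < t →
    dirDeriv (scalarLift h) (scale t u) (W (scale t u)) = t ^ 2 * dirDeriv (scalarLift h) u (W u)

/-- Bivector fields. -/
abbrev BivField (n : ℕ) (M : Type*) [TopologicalSpace M]
    [ChartedSpace (EuclideanSpace ℝ (Fin n)) M] [IsManifold (𝓡 n) ∞ M] : Type _ :=
  ∀ u : TangentBundle (𝓡 n) M, ⋀[ℝ]^2 (TangentSpace (𝓡 n).tangent u)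

/-- The bivector field `X ∧ Y`. -/
def wedge (X Y : VField (𝓡 n).tangent (TangentBundle (𝓡 n) M)) : BivField n M := fun u =>
  exteriorPower.ιMulti ℝ 2 ![X u, Y u]

/-- `Φ = X ∧ Y` on `U` for two smooth vector fields on `U`. -/
def Represents (U : Set (TangentBundle (𝓡 n) M)) (Φ : BivField n M)
    (X Y : VField (𝓡 n).tangent (TangentBundle (𝓡 n) M)) : Prop :=
  SmoothField (𝓡 n).tangent U X ∧ SmoothField (𝓡 n).tangent U Y ∧
    ∀ u ∈ U, Φ u = wedge X Y u

/-- A Vlasov bivector on `U`: a simple bivector of the form `R ∧ W` with `R` the radial field and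
`W` a Vlasov field. Such a bivector is radial and horizontal because `W` is horizontal. -/
structure IsVlasovBivector (U : Set (TangentBundle (𝓡 n) M)) (Ψ : BivField n M) : Prop where
  simple : ∃ X Y, Represents U Ψ X Y
  eq_wedge : ∃ W, IsVlasovField U W ∧ ∀ u ∈ U, Ψ u = wedge radialField W u

/-- The null condition `Null(Φ, α)` on `U`. -/
def NullCondition (U : Set (TangentBundle (𝓡 n) M)) (Φ : BivField n M) {k : ℕ}
    (α : DForm (𝓡 n).tangent (TangentBundle (𝓡 n) M) k) : Prop :=
  ∀ X Y, Represents U Φ X Y →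
    ∀ u ∈ U, interiorProd (X u) (α u) = 0 ∧ interiorProd (Y u) (α u) = 0

/-- `Ψ` is a Vlasov bivector, `θ` is a smooth form of degree `2n - 2`, and the pair satisfies the
transport equations on `U`: `Null(Ψ, θ)` and `dθ = 0`. -/
structure TransportOnU (U : Set (TangentBundle (𝓡 n) M)) (Ψ : BivField n M)
    (θ : DForm (𝓡 n).tangent (TangentBundle (𝓡 n) M) (2 * n - 2)) : Prop where
  vlasov : IsVlasovBivector U Ψ
  smooth : SmoothForm (𝓡 n).tangent U θ
  null : NullCondition U Ψ θ
  closed : ∀ u ∈ U, extD (𝓡 n).tangent U θ u = 0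

section Domain

variable {H : Type*} [TopologicalSpace H]
  {J : ModelWithCorners ℝ (EuclideanSpace ℝ (Fin (2 * n - 1))) H}
  {E : Type*} [TopologicalSpace E] [ChartedSpace H E]

variable (J) in
/-- The `(2n-1)`-dimensional manifold `E` (with boundary if `U` has one), with the inclusion
`ιE : E → TM`, is a kinematic domain in `U`. By `hypersurface`, near each of its points `E` is cut
out of `U` by one smooth equation `F = 0` with `R⟨F⟩ ≠ 0`, that is, `E` is a hypersurface of `U`
transverse to the radial field. -/
structure IsKinematicDomain (U Up : Set (TangentBundle (𝓡 n) M))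
    (ιE : E → TangentBundle (𝓡 n) M) : Prop where
  embedding : IsSmoothEmbedding J (𝓡 n).tangent ∞ ιE
  mem_future : ∀ v, ιE v ∈ Up
  proj_surj : Function.Surjective fun v => (ιE v).proj
  connected : ConnectedSpace E
  ray : ∀ u ∈ U, ∃! q : E × ℝ, q.2 ≠ 0 ∧ u = scale q.2 (ιE q.1)
  hypersurface : ∀ v, ∃ O : Set (TangentBundle (𝓡 n) M), IsOpen O ∧ ιE v ∈ O ∧
    ∃ F : TangentBundle (𝓡 n) M → ℝ, ContMDiffOn (𝓡 n).tangent 𝓘(ℝ, ℝ) ∞ F O ∧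
      range ιE ∩ O = {u ∈ U ∩ O | F u = 0} ∧
      dirDeriv F (ιE v) (radialField (ιE v)) ≠ 0

variable [IsManifold J ∞ E]

/-- A Vlasov field on the kinematic domain `E`: smooth and horizontal. -/
structure IsVlasovFieldOnE (ιE : E → TangentBundle (𝓡 n) M) (WE : VField J E) : Prop where
  smooth : SmoothField J univ WE
  horizontal : ∀ v, mfderiv J (𝓡 n) (fun v' => (ιE v').proj) v (WE v) = (ιE v).snd

/-- The transport equations on `E` for the smooth `(2n-2)`-form `θE` and the field `WE`. -/
structure TransportOnE (WE : VField J E) (θE : DForm J E (2 * n - 2)) : Prop where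
  smooth : SmoothForm J univ θE
  closed : ∀ v, extD J univ θE v = 0
  tangent : ∀ v, interiorProd (WE v) (θE v) = 0

/-- The Vlasov field `W` on `U` is an extension of `WE`: it is tangent to `E` and induces `WE`. -/
structure IsExtension (U : Set (TangentBundle (𝓡 n) M)) (ιE : E → TangentBundle (𝓡 n) M)
    (WE : VField J E) (W : VField (𝓡 n).tangent (TangentBundle (𝓡 n) M)) : Prop where
  vlasov : IsVlasovField U W
  induced : ∀ v, mfderiv J (𝓡 n).tangent ιE v (WE v) = W (ιE v)

/-- The radial projection `Π : U⁺ → E`, `Π(t v) = v` for `t > 0` (with arbitrary values at vectors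
that are not on a positive ray through `E`). -/
def radialProj [Nonempty E] (ιE : E → TangentBundle (𝓡 n) M) (u : TangentBundle (𝓡 n) M) : E :=
  Classical.epsilon fun v => ∃ t : ℝ, 0 < t ∧ u = scale t (ιE v)

open Classical in
/-- The future pointing form `θ` with `θ = Π^* θE` on `U⁺` and `θ = 0` on `U⁻`. -/
def futureForm [Nonempty E] (Up : Set (TangentBundle (𝓡 n) M)) (ιE : E → TangentBundle (𝓡 n) M)
    {k : ℕ} (θE : DForm J E k) : DForm (𝓡 n).tangent (TangentBundle (𝓡 n) M) k := fun u =>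
  if u ∈ Up then
    (θE (radialProj ιE u)).compContinuousLinearMap
      (mfderivWithin (𝓡 n).tangent J (radialProj ιE) Up u)
  else 0

end Domain

end Conic

end

end Vlasov

/-!
Because the causal indicator is continuous, `U⁺` and `U⁻` are open in `U`, so near each point of `U`
the form `θ` is either `Π^* θE` or zero. The projection `Π` is smooth: transversality to the radial
field lets one solve `F (t z) = 0` for `t = σ z` by the implicit function theorem, then
`ιE (Π z) = σ z • z`, and `ιE` is a smooth embedding. Hence `θ` is smooth, and it is closed because
pullback commutes with `d`; up to the boundary of `U` this last identity follows from the interior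
by continuity. Since `Π` is constant on rays, `Π_* R = 0`. A tangent vector to `TM` is determined by
its projection to `M` and its action on the scalar lifts `ḣ`, so the quadratic homogeneity of `W`
says `W (t u) = t (m_t)_* W (u)` with `m_t` the multiplication by `t`; thus `Π_* W` is a multiple
of `W_E` and both `R` and `W` annihilate `θ`. Finally `R` and `W` are linearly independent, so
`R ∧ W = X ∧ Y` forces `X` and `Y` into their span.
-/

namespace Vlasov

noncomputable section

section AlternatingMaps

variable {𝕜 : Type*} [NontriviallyNormedField 𝕜]
  {V V' F : Type*} [NormedAddCommGroup V] [NormedSpace 𝕜 V] [NormedAddCommGroup V']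
  [NormedSpace 𝕜 V'] [NormedAddCommGroup F] [NormedSpace 𝕜 F]
  {ι : Type*} [Fintype ι]

open ContinuousMultilinearMap in
/-- Alternatization of continuous multilinear maps as a continuous linear map. -/
def alternatizationCLM (𝕜 V F ι : Type*) [NontriviallyNormedField 𝕜] [NormedAddCommGroup V]
    [NormedSpace 𝕜 V] [NormedAddCommGroup F] [NormedSpace 𝕜 F] [Fintype ι] [DecidableEq ι] :
    ContinuousMultilinearMap 𝕜 (fun _ : ι => V) F →L[𝕜] V [⋀^ι]→L[𝕜] F where
  toFun := alternatization
  map_add' := map_add _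
  map_smul' c f := by
    ext v
    simp only [alternatization_apply_apply, ContinuousAlternatingMap.smul_apply,
      _root_.smul_apply, Finset.smul_sum, smul_comm c, RingHom.id_apply]
  cont := by
    refine ContinuousAlternatingMap.isEmbedding_toContinuousMultilinearMap.continuous_iff.2 ?_
    refine continuous_finsetSum _ fun σ _ => ?_
    exact (domDomCongrₗᵢ 𝕜 V F σ).continuous.const_smul (Equiv.Perm.sign σ)

lemma alternatizationCLM_toContinuousMultilinearMap [DecidableEq ι] (η : V [⋀^ι]→L[𝕜] F) :
    alternatizationCLM 𝕜 V F ι η.toContinuousMultilinearMap = (Fintype.card ι).factorial • η :=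
  ContinuousAlternatingMap.toAlternatingMap_injective <|
    (ContinuousMultilinearMap.alternatization_apply_toAlternatingMap _).trans
      (AlternatingMap.coe_alternatization η.toAlternatingMap)

lemma contDiffOn_compContinuousLinearMap [CharZero 𝕜] {B : Type*} [NormedAddCommGroup B]
    [NormedSpace 𝕜 B] {r : WithTop ℕ∞} {η : B → V' [⋀^ι]→L[𝕜] F} {L : B → V →L[𝕜] V'} {s : Set B}
    (hη : ContDiffOn 𝕜 r η s) (hL : ContDiffOn 𝕜 r L s) :
    ContDiffOn 𝕜 r (fun y => (η y).compContinuousLinearMap (L y)) s := by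
  classical
  have hηm : ContDiffOn 𝕜 r (fun y => (η y).toContinuousMultilinearMap) s :=
    (ContinuousAlternatingMap.toContinuousMultilinearMapLI :
      (V' [⋀^ι]→L[𝕜] F) →ₗᵢ[𝕜] _).contDiff.comp_contDiffOn hη
  have hcomp : ContDiffOn 𝕜 r (fun y =>
      ContinuousMultilinearMap.compContinuousLinearMapContinuousMultilinear 𝕜
        (fun _ : ι => V) (fun _ => V') F (fun _ => L y)) s :=
    (ContinuousMultilinearMap.contDiff _).comp_contDiffOn (contDiffOn_pi.2 fun _ => hL)
  refine (((alternatizationCLM 𝕜 V F ι).contDiff.comp_contDiffOn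
    (hcomp.clm_apply hηm)).const_smul (((Fintype.card ι).factorial : 𝕜)⁻¹)).congr fun y _ => ?_
  have hfac : ((Fintype.card ι).factorial : 𝕜) ≠ 0 := by
    exact_mod_cast (Fintype.card ι).factorial_ne_zero
  exact ((inv_smul_eq_iff₀ hfac).2 ((alternatizationCLM_toContinuousMultilinearMap
    ((η y).compContinuousLinearMap (L y))).trans (Nat.cast_smul_eq_nsmul 𝕜 _ _).symm)).symm

end AlternatingMaps

section Forms

lemma extDerivWithin_congr_set {𝕜 V F : Type*} [NontriviallyNormedField 𝕜] [NormedAddCommGroup V]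
    [NormedSpace 𝕜 V] [NormedAddCommGroup F] [NormedSpace 𝕜 F] {k : ℕ} {η : V → V [⋀^Fin k]→L[𝕜] F}
    {s t : Set V} {x : V} (h : s =ᶠ[𝓝 x] t) : extDerivWithin η s x = extDerivWithin η t x := by
  rw [extDerivWithin, extDerivWithin, fderivWithin_congr_set h]

variable {G : Type*} [NormedAddCommGroup G] [NormedSpace ℝ G]
  {H : Type*} [TopologicalSpace H] {I : ModelWithCorners ℝ G H}
  {N : Type*} [TopologicalSpace N] [ChartedSpace H N] {S S' : Set N} {k : ℕ} {α β : DForm I N k}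

lemma extD_eq_extDerivWithin [IsManifold I 1 N] (S : Set N) (α : DForm I N k) (x : N) :
    extD I S α x = extDerivWithin (coordForm I α x) ((extChartAt I x).symm ⁻¹' S ∩ range I)
      (extChartAt I x x) := by
  rw [extD, mfderiv_extChartAt_self]
  rfl

lemma tendsto_extChartAt_symm_nhds (x : N) :
    Filter.Tendsto (extChartAt I x).symm (𝓝 (extChartAt I x x)) (𝓝 x) := by
  simpa only [ContinuousAt, extChartAt_to_inv] using continuousAt_extChartAt_symm (I := I) x

lemma extD_congr_set {x : N} (h : S =ᶠ[𝓝 x] S') : extD I S α x = extD I S' α x := by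
  have hpre : (extChartAt I x).symm ⁻¹' S =ᶠ[𝓝 (extChartAt I x x)] (extChartAt I x).symm ⁻¹' S' :=
    h.comp_tendsto (tendsto_extChartAt_symm_nhds x)
  rw [extD, extD, extDerivWithin_congr_set (hpre.inter (.refl _ (range I)))]

lemma extD_congr {x : N} (hx : x ∈ S) (h : ∀ᶠ z in 𝓝[S] x, α z = β z) :
    extD I S α x = extD I S β x := by
  have htendsto : Filter.Tendsto (extChartAt I x).symm
      (𝓝[(extChartAt I x).symm ⁻¹' S ∩ range I] (extChartAt I x x)) (𝓝[S] x) :=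
    tendsto_nhdsWithin_iff.2 ⟨(tendsto_extChartAt_symm_nhds x).mono_left nhdsWithin_le_nhds,
      eventually_mem_nhdsWithin.mono fun _ hz => hz.1⟩
  have hcoord : coordForm I α x =ᶠ[𝓝[(extChartAt I x).symm ⁻¹' S ∩ range I] (extChartAt I x x)]
      coordForm I β x :=
    (htendsto.eventually h).mono fun z hz => by rw [coordForm, coordForm, hz]
  rw [extD, extD, hcoord.extDerivWithin_eq_of_mem
    ⟨by rwa [mem_preimage, extChartAt_to_inv], mem_range_self _⟩]

lemma SmoothForm.congr (hβ : SmoothForm I S β) (h : ∀ z ∈ S, α z = β z) : SmoothForm I S α :=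
  fun x₀ => (hβ x₀).congr fun z hz => by rw [coordForm, coordForm, h _ hz.2]

lemma smoothForm_of_locally (h : ∀ x ∈ S, ∃ T ∈ 𝓝[S] x, SmoothForm I T α) :
    SmoothForm I S α := by
  intro x₀ y hy
  obtain ⟨T, hT, hα⟩ := h _ hy.2
  have htendsto : Filter.Tendsto (extChartAt I x₀).symm
      (𝓝[(extChartAt I x₀).target ∩ (extChartAt I x₀).symm ⁻¹' S] y)
      (𝓝[S] ((extChartAt I x₀).symm y)) :=
    (((continuousOn_extChartAt_symm x₀) y hy.1).mono inter_subset_left).tendsto_nhdsWithin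
      fun z hz => hz.2
  have hyT : (extChartAt I x₀).symm y ∈ T := mem_of_mem_nhdsWithin hy.2 hT
  refine (hα x₀ y ⟨hy.1, hyT⟩).mono_of_mem_nhdsWithin ?_
  filter_upwards [htendsto hT, self_mem_nhdsWithin] with z hzT hz
  exact ⟨hz.1, hzT⟩

lemma smoothForm_zero (S : Set N) (k : ℕ) : SmoothForm I S (fun _ => 0 : DForm I N k) :=
  fun _ => contDiffOn_const (c := (0 : G [⋀^Fin k]→L[ℝ] ℝ))

lemma extD_zero [IsManifold I 1 N] (S : Set N) (k : ℕ) (x : N) :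
    extD I S (fun _ => 0 : DForm I N k) x = 0 := by
  have hcoord : coordForm I (fun _ => 0 : DForm I N k) x = fun _ => 0 := rfl
  rw [extD_eq_extDerivWithin, hcoord, extDerivWithin, fderivWithin_const_apply]
  exact map_zero (ContinuousAlternatingMap.alternatizeUncurryFinCLM ℝ G ℝ)

end Forms

section Pullback

variable {G : Type*} [NormedAddCommGroup G] [NormedSpace ℝ G]
  {H : Type*} [TopologicalSpace H] {I : ModelWithCorners ℝ G H}
  {N : Type*} [TopologicalSpace N] [ChartedSpace H N]
  {G' : Type*} [NormedAddCommGroup G'] [NormedSpace ℝ G']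
  {H' : Type*} [TopologicalSpace H'] {J : ModelWithCorners ℝ G' H'}
  {P : Type*} [TopologicalSpace P] [ChartedSpace H' P]
  {S : Set N} {f : N → P} {x₀ : N} {p₀ : P} {y : G} {k : ℕ} {α : DForm J P k}

/-- The pullback `(f|_S)^* α` of the form `α` on `P`, where `f : N → P` is only differentiated
within the set `S`. -/
def pullbackForm (I : ModelWithCorners ℝ G H) (S : Set N) (f : N → P) (α : DForm J P k) :
    DForm I N k := fun x =>
  (α (f x)).compContinuousLinearMap (mfderivWithin I J f S x)

/-- The domain of the expression of `f|_S` in the charts at `x₀` and `p₀`. -/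
def chartDomain (I : ModelWithCorners ℝ G H) (J : ModelWithCorners ℝ G' H') (S : Set N)
    (f : N → P) (x₀ : N) (p₀ : P) : Set G :=
  (extChartAt I x₀).target ∩ (extChartAt I x₀).symm ⁻¹' (S ∩ f ⁻¹' (extChartAt J p₀).source)

/-- The expression of `f` in the charts at `x₀` and `p₀`; it is meaningful on `chartDomain`. -/
def chartExpr (I : ModelWithCorners ℝ G H) (J : ModelWithCorners ℝ G' H')
    (f : N → P) (x₀ : N) (p₀ : P) (y : G) : G' :=
  extChartAt J p₀ (f ((extChartAt I x₀).symm y))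

lemma chartExpr_mem_target (hy : y ∈ chartDomain I J S f x₀ p₀) :
    chartExpr I J f x₀ p₀ y ∈ (extChartAt J p₀).target :=
  (extChartAt J p₀).map_source hy.2.2

lemma extChartAt_symm_chartExpr (hy : y ∈ chartDomain I J S f x₀ p₀) :
    (extChartAt J p₀).symm (chartExpr I J f x₀ p₀ y) = f ((extChartAt I x₀).symm y) :=
  (extChartAt J p₀).left_inv hy.2.2

lemma chartExpr_extChartAt_self (f : N → P) (x : N) :
    chartExpr I J f x (f x) (extChartAt I x x) = extChartAt J (f x) (f x) := by
  rw [chartExpr, extChartAt_to_inv]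

lemma extChartAt_self_mem_chartDomain {x : N} (hx : x ∈ S) :
    extChartAt I x x ∈ chartDomain I J S f x (f x) := by
  refine ⟨mem_extChartAt_target x, ?_⟩
  rw [mem_preimage, extChartAt_to_inv]
  exact ⟨hx, mem_extChartAt_source (f x)⟩

lemma chartDomain_eventuallyEq (hf : ContinuousOn f S) (hy : y ∈ chartDomain I J S f x₀ p₀) :
    chartDomain I J S f x₀ p₀ =ᶠ[𝓝 y] ((extChartAt I x₀).symm ⁻¹' S ∩ range I : Set G) := by
  have htarget : (extChartAt I x₀).target ∈ 𝓝[(extChartAt I x₀).symm ⁻¹' S ∩ range I] y :=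
    nhdsWithin_mono _ inter_subset_right (extChartAt_target_mem_nhdsWithin_of_mem hy.1)
  have hsymm : Filter.Tendsto (extChartAt I x₀).symm
      (𝓝[(extChartAt I x₀).symm ⁻¹' S ∩ range I] y) (𝓝[S] ((extChartAt I x₀).symm y)) :=
    ((contMDiffWithinAt_extChartAt_symm_range (n := 0) x₀ hy.1).continuousWithinAt.mono
      inter_subset_right).tendsto_nhdsWithin fun _ hz => hz.1
  have hsource : f ⁻¹' (extChartAt J p₀).source ∈ 𝓝[S] ((extChartAt I x₀).symm y) :=
    (hf _ hy.2.1).preimage_mem_nhdsWithin ((isOpen_extChartAt_source p₀).mem_nhds hy.2.2)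
  filter_upwards [mem_nhdsWithin_iff_eventually.1 htarget,
    mem_nhdsWithin_iff_eventually.1 (hsymm hsource)] with z hzt hzs
  exact propext ⟨fun hz => ⟨hz.2.1, extChartAt_target_subset_range x₀ hz.1⟩,
    fun hz => ⟨hzt hz, hz.1, hzs hz⟩⟩

lemma chartDomain_mem_nhdsWithin (hf : ContinuousOn f S) (hy : y ∈ chartDomain I J S f x₀ p₀) :
    chartDomain I J S f x₀ p₀ ∈ 𝓝[(extChartAt I x₀).symm ⁻¹' S ∩ range I] y := by
  rw [← nhdsWithin_eq_iff_eventuallyEq.2 (chartDomain_eventuallyEq hf hy)]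
  exact self_mem_nhdsWithin

lemma extChartAt_self_mem_closure_interior_chartDomain (hf : ContinuousOn f S) {x : N} (hx : x ∈ S)
    (hxS : x ∈ closure (interior S)) :
    extChartAt I x x ∈ closure (interior (chartDomain I J S f x (f x))) := by
  have hset := chartDomain_eventuallyEq (I := I) (J := J) hf (extChartAt_self_mem_chartDomain hx)
  have hclosure : extChartAt I x x ∈ closure (interior ((extChartAt I x).symm ⁻¹' S ∩ range I)) :=
    closure_mono (interior_mono (inter_subset_inter_right _ (extChartAt_target_subset_range x)))
      (extChartAt_mem_closure_interior hxS (mem_extChartAt_source x))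
  rw [mem_closure_iff_frequently] at hclosure ⊢
  refine (hclosure.and_eventually hset.eventuallyEq_nhds).mono fun z hz => ?_
  rw [mem_interior_iff_mem_nhds] at hz ⊢
  filter_upwards [hz.1, hz.2.mem_iff] with w hw hiff using hiff.2 hw

lemma contDiffOn_chartExpr [IsManifold I ∞ N] [IsManifold J ∞ P] (hf : ContMDiffOn I J ∞ f S)
    (x₀ : N) (p₀ : P) :
    ContDiffOn ℝ ∞ (chartExpr I J f x₀ p₀) (chartDomain I J S f x₀ p₀) :=
  (contMDiffOn_iff.1 hf).2 x₀ p₀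

lemma uniqueDiffOn_chartDomain [IsManifold I 1 N] (hS : UniqueMDiffOn I S)
    (hf : ContinuousOn f S) (x₀ : N) (p₀ : P) : UniqueDiffOn ℝ (chartDomain I J S f x₀ p₀) :=
  hS.uniqueDiffOn_inter_preimage x₀ p₀ hf

lemma mfderivWithin_eq_fderivWithin_chartExpr (hf : ContinuousOn f S) {x : N} (hx : x ∈ S)
    (hfx : MDifferentiableWithinAt I J f S x) :
    mfderivWithin I J f S x = fderivWithin ℝ (chartExpr I J f x (f x))
      (chartDomain I J S f x (f x)) (extChartAt I x x) :=
  (if_pos hfx).trans (fderivWithin_congr_set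
    (chartDomain_eventuallyEq hf (extChartAt_self_mem_chartDomain hx))).symm

variable [IsManifold I ∞ N] [IsManifold J ∞ P]

lemma mfderivWithin_comp_mfderivWithin_extChartAt_symm (hS : UniqueMDiffOn I S)
    (hf : ContMDiffOn I J ∞ f S) (hy : y ∈ chartDomain I J S f x₀ p₀) :
    (mfderivWithin I J f S ((extChartAt I x₀).symm y)).comp
        (mfderivWithin 𝓘(ℝ, G) I (extChartAt I x₀).symm (range I) y) =
      (mfderivWithin 𝓘(ℝ, G') J (extChartAt J p₀).symm (range J) (chartExpr I J f x₀ p₀ y)).comp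
        (mfderivWithin 𝓘(ℝ, G) 𝓘(ℝ, G') (chartExpr I J f x₀ p₀)
          (chartDomain I J S f x₀ p₀) y) := by
  have hunique : UniqueMDiffWithinAt 𝓘(ℝ, G) (chartDomain I J S f x₀ p₀) y :=
    (uniqueDiffOn_chartDomain hS hf.continuousOn x₀ p₀ y hy).uniqueMDiffWithinAt
  have hexpr : MDifferentiableWithinAt 𝓘(ℝ, G) 𝓘(ℝ, G') (chartExpr I J f x₀ p₀)
      (chartDomain I J S f x₀ p₀) y :=
    ((contDiffOn_chartExpr hf x₀ p₀ y hy).differentiableWithinAt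
      (by simp)).mdifferentiableWithinAt
  have hright := (mdifferentiableWithinAt_extChartAt_symm
    (chartExpr_mem_target hy)).hasMFDerivWithinAt.comp y hexpr.hasMFDerivWithinAt
    fun _ hz => extChartAt_target_subset_range p₀ (chartExpr_mem_target hz)
  have hleft := ((hf _ hy.2.1).mdifferentiableWithinAt (by simp)).hasMFDerivWithinAt.comp y
    ((mdifferentiableWithinAt_extChartAt_symm hy.1).hasMFDerivWithinAt.mono
      fun _ (hz : _ ∈ chartDomain I J S f x₀ p₀) => extChartAt_target_subset_range x₀ hz.1)
    fun _ hz => hz.2.1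
  exact hunique.eq (hleft.congr_of_eventuallyEq
    (eventually_mem_nhdsWithin.mono fun _ hz => extChartAt_symm_chartExpr hz)
    (extChartAt_symm_chartExpr hy)) hright

lemma coordForm_pullbackForm (hS : UniqueMDiffOn I S) (hf : ContMDiffOn I J ∞ f S)
    (α : DForm J P k) (hy : y ∈ chartDomain I J S f x₀ p₀) :
    coordForm I (pullbackForm I S f α) x₀ y =
      (coordForm J α p₀ (chartExpr I J f x₀ p₀ y)).compContinuousLinearMap
        (fderivWithin ℝ (chartExpr I J f x₀ p₀) (chartDomain I J S f x₀ p₀) y) := by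
  let A : P → G' [⋀^Fin k]→L[ℝ] ℝ := α
  have hα : A (f ((extChartAt I x₀).symm y)) =
      A ((extChartAt J p₀).symm (chartExpr I J f x₀ p₀ y)) :=
    congrArg A (extChartAt_symm_chartExpr hy).symm
  ext v
  change A _ _ = A _ _
  rw [hα]
  congr 1
  funext i
  refine (DFunLike.congr_fun (mfderivWithin_comp_mfderivWithin_extChartAt_symm hS hf hy)
    (v i)).trans ?_
  rw [mfderivWithin_eq_fderivWithin]
  rfl

lemma smoothForm_pullbackForm (hS : UniqueMDiffOn I S) (hf : ContMDiffOn I J ∞ f S)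
    (hα : SmoothForm J univ α) : SmoothForm I S (pullbackForm I S f α) := by
  intro x₀ y hy
  set p₀ := f ((extChartAt I x₀).symm y)
  have hyT : y ∈ chartDomain I J S f x₀ p₀ := ⟨hy.1, hy.2, mem_extChartAt_source p₀⟩
  have hexpr := contDiffOn_chartExpr hf x₀ p₀
  have hcoord : ContDiffOn ℝ ∞ (coordForm I (pullbackForm I S f α) x₀)
      (chartDomain I J S f x₀ p₀) :=
    (contDiffOn_compContinuousLinearMap
      ((hα p₀).comp hexpr fun _ hz => ⟨chartExpr_mem_target hz, mem_univ _⟩)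
      (hexpr.fderivWithin (uniqueDiffOn_chartDomain hS hf.continuousOn x₀ p₀) (by simp))).congr
      fun _ hz => coordForm_pullbackForm hS hf α hz
  have hsub : (extChartAt I x₀).target ∩ (extChartAt I x₀).symm ⁻¹' S ⊆
      (extChartAt I x₀).symm ⁻¹' S ∩ range I :=
    fun z hz => ⟨hz.2, extChartAt_target_subset_range x₀ hz.1⟩
  exact (hcoord y hyT).mono_of_mem_nhdsWithin
    (nhdsWithin_mono _ hsub (chartDomain_mem_nhdsWithin hf.continuousOn hyT))

lemma extD_pullbackForm (hS : UniqueMDiffOn I S) (hf : ContMDiffOn I J ∞ f S)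
    (hα : SmoothForm J univ α) {x : N} (hx : x ∈ S) (hxS : x ∈ closure (interior S)) :
    extD I S (pullbackForm I S f α) x = pullbackForm I S f (extD J univ α) x := by
  have hxT := extChartAt_self_mem_chartDomain (I := I) (J := J) (f := f) hx
  have hgx : chartExpr I J f x (f x) (extChartAt I x x) = extChartAt J (f x) (f x) :=
    chartExpr_extChartAt_self f x
  have hdiff : DifferentiableWithinAt ℝ (coordForm J α (f x)) (range J)
      (chartExpr I J f x (f x) (extChartAt I x x)) := by
    rw [hgx]
    refine ((hα (f x) _ ⟨mem_extChartAt_target _, mem_univ _⟩).differentiableWithinAt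
      (by simp)).mono_of_mem_nhdsWithin ?_
    rw [preimage_univ, inter_univ]
    exact extChartAt_target_mem_nhdsWithin (f x)
  have hpull := extDerivWithin_pullback hdiff (contDiffOn_chartExpr hf x (f x) _ hxT) (r := ∞)
    (by rw [minSmoothness_of_isRCLikeNormedField]; exact WithTop.coe_le_coe.2 le_top)
    (uniqueDiffOn_chartDomain hS hf.continuousOn x (f x))
    (extChartAt_self_mem_closure_interior_chartDomain hf.continuousOn hx hxS) hxT
    fun _ hz => extChartAt_target_subset_range _ (chartExpr_mem_target hz)
  rw [extD_eq_extDerivWithin, pullbackForm, extD_eq_extDerivWithin, preimage_univ, univ_inter,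
    mfderivWithin_eq_fderivWithin_chartExpr hf.continuousOn hx
      ((hf x hx).mdifferentiableWithinAt (by simp)), ← hgx]
  exact (extDerivWithin_congr_set (chartDomain_eventuallyEq hf.continuousOn hxT)).symm.trans
    ((extDerivWithin_congr' (fun _ hz => coordForm_pullbackForm hS hf α hz) hxT).trans hpull)

end Pullback

section Velocity

variable {G : Type*} [NormedAddCommGroup G] [NormedSpace ℝ G]
  {H : Type*} [TopologicalSpace H] {I : ModelWithCorners ℝ G H}
  {N : Type*} [TopologicalSpace N] [ChartedSpace H N] [IsManifold I ∞ N]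
  {G' : Type*} [NormedAddCommGroup G'] [NormedSpace ℝ G']
  {H' : Type*} [TopologicalSpace H'] {J : ModelWithCorners ℝ G' H'}
  {P : Type*} [TopologicalSpace P] [ChartedSpace H' P] [IsManifold J ∞ P]

lemma contMDiff_velocity {φ : ℝ × N → P} (hφ : ContMDiff (𝓘(ℝ, ℝ).prod I) J ∞ φ) (t : ℝ) :
    ContMDiff I J.tangent ∞ (fun x =>
      (⟨φ (t, x), mfderiv 𝓘(ℝ, ℝ) J (fun s => φ (s, x)) t (1 : ℝ)⟩ : TangentBundle J P)) := by
  have hone : ContMDiff I 𝓘(ℝ, ℝ).tangent ∞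
      (fun _ : N => (⟨t, (1 : ℝ)⟩ : TangentBundle 𝓘(ℝ, ℝ) ℝ)) := contMDiff_const
  have hzero : ContMDiff I I.tangent ∞ (fun x : N => (⟨x, 0⟩ : TangentBundle I N)) :=
    Bundle.contMDiff_zeroSection ℝ _
  have htangent := (hφ.contMDiff_tangentMap (m := ∞) (by simp)).comp
    ((contMDiff_equivTangentBundleProd_symm (I := 𝓘(ℝ, ℝ)) (M := ℝ) (I' := I) (M' := N)
      (n := ∞)).comp (hone.prodMk hzero))
  refine htangent.congr fun x => congrArg (Bundle.TotalSpace.mk _) ?_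
  have hcomp := HasMFDerivAt.comp t (hφ.mdifferentiable (by simp) (t, x)).hasMFDerivAt
    ((hasMFDerivAt_id t).prodMk (hasMFDerivAt_const x t))
  exact DFunLike.congr_fun hcomp.mfderiv (1 : ℝ)

end Velocity

section Scale

variable {n : ℕ} {M : Type*} [TopologicalSpace M] [ChartedSpace (EuclideanSpace ℝ (Fin n)) M]

lemma scale_scale (s t : ℝ) (u : TangentBundle (𝓡 n) M) :
    scale s (scale t u) = scale (s * t) u :=
  congrArg (Bundle.TotalSpace.mk u.proj) (smul_smul s t u.snd)

lemma scale_one (u : TangentBundle (𝓡 n) M) : scale 1 u = u := by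
  simp only [scale, one_smul]

variable [IsManifold (𝓡 n) ∞ M]

lemma contMDiff_scale : ContMDiff (𝓘(ℝ, ℝ).prod (𝓡 n).tangent) (𝓡 n).tangent ∞
    (fun q : ℝ × TangentBundle (𝓡 n) M => scale q.1 q.2) := by
  intro q
  have hsnd := Bundle.contMDiffAt_totalSpace.1
    (contMDiffAt_snd (I := 𝓘(ℝ, ℝ)) (J := (𝓡 n).tangent) (n := ∞) (p := q))
  refine Bundle.contMDiffAt_totalSpace.2
    ⟨hsnd.1, (contMDiffAt_fst.smul hsnd.2).congr_of_eventuallyEq ?_⟩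
  let e := trivializationAt (EuclideanSpace ℝ (Fin n)) (TangentSpace (𝓡 n) : M → Type _) q.2.proj
  have hbase : ∀ᶠ z in 𝓝 q, z.2.proj ∈ e.baseSet :=
    hsnd.1.continuousAt.preimage_mem_nhds
      (e.open_baseSet.mem_nhds (FiberBundle.mem_baseSet_trivializationAt' _))
  filter_upwards [hbase] with z hz using (e.linear ℝ hz).map_smul z.1 z.2.snd

lemma contMDiff_scale_left (t : ℝ) : ContMDiff (𝓡 n).tangent (𝓡 n).tangent ∞
    (scale t : TangentBundle (𝓡 n) M → TangentBundle (𝓡 n) M) :=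
  contMDiff_scale.comp (contMDiff_const.prodMk contMDiff_id)

lemma contMDiff_scale_right (u : TangentBundle (𝓡 n) M) :
    ContMDiff 𝓘(ℝ, ℝ) (𝓡 n).tangent ∞ (fun t : ℝ => scale t u) :=
  contMDiff_scale.comp (contMDiff_id.prodMk contMDiff_const)

lemma hasMFDerivAt_scale (u : TangentBundle (𝓡 n) M) :
    HasMFDerivAt 𝓘(ℝ, ℝ) (𝓡 n).tangent (fun t : ℝ => scale t u) 1
      (mfderiv 𝓘(ℝ, ℝ) (𝓡 n).tangent (fun t : ℝ => scale t u) 1) :=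
  ((contMDiff_scale_right u).mdifferentiable (by simp) 1).hasMFDerivAt

lemma smoothField_radialField (S : Set (TangentBundle (𝓡 n) M)) :
    SmoothField (𝓡 n).tangent S (radialField : VField (𝓡 n).tangent (TangentBundle (𝓡 n) M)) :=
  ContMDiff.contMDiffOn <| (contMDiff_velocity contMDiff_scale 1).congr fun u =>
    Bundle.TotalSpace.ext (scale_one u).symm HEq.rfl

end Scale

section LinearAlgebra

variable {K V : Type*} [Field K] [AddCommGroup V] [Module K V] {a b x y : V}

lemma exteriorAlgebra_ιMulti_ne_zero {m : ℕ} {v : Fin m → V} (hv : LinearIndependent K v) :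
    ExteriorAlgebra.ιMulti K m v ≠ 0 := by
  have hne := (exteriorPower.ιMulti_family_linearIndependent_field (n := m) hv).ne_zero
    (Set.powersetCard.ofFinEmbEquiv (RelEmbedding.refl _))
  rw [exteriorPower.ιMulti_family, Equiv.symm_apply_apply] at hne
  exact fun h => hne (Subtype.ext h)

lemma left_mem_span_of_ιMulti_eq (hab : LinearIndependent K ![a, b])
    (h : exteriorPower.ιMulti K 2 ![a, b] = exteriorPower.ιMulti K 2 ![x, y]) :
    x ∈ Submodule.span K {a, b} := by
  by_contra hx
  have hxab : LinearIndependent K ![x, a, b] :=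
    linearIndependent_finCons.2 ⟨hab, by rwa [Matrix.range_cons_cons_empty]⟩
  refine exteriorAlgebra_ιMulti_ne_zero hxab ?_
  calc ExteriorAlgebra.ιMulti K 3 ![x, a, b]
      = ExteriorAlgebra.ι K x * ExteriorAlgebra.ιMulti K 2 ![a, b] :=
        ExteriorAlgebra.ιMulti_succ_apply _
    _ = ExteriorAlgebra.ι K x * ExteriorAlgebra.ιMulti K 2 ![x, y] :=
        congrArg _ (congrArg Subtype.val h)
    _ = 0 := by
        simp [ExteriorAlgebra.ιMulti_succ_apply, ← mul_assoc]

lemma ιMulti_pair_swap (a b : V) :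
    exteriorPower.ιMulti K 2 ![a, b] = -exteriorPower.ιMulti K 2 ![b, a] := by
  rw [← (exteriorPower.ιMulti K 2 (M := V)).map_swap ![b, a] (i := 0) (j := 1) (by simp)]
  congr 1
  ext i
  fin_cases i <;> rfl

lemma right_mem_span_of_ιMulti_eq (hab : LinearIndependent K ![a, b])
    (h : exteriorPower.ιMulti K 2 ![a, b] = exteriorPower.ιMulti K 2 ![x, y]) :
    y ∈ Submodule.span K {a, b} := by
  rw [Set.pair_comm]
  refine left_mem_span_of_ιMulti_eq (y := x) (LinearIndependent.pair_symm_iff.1 hab) ?_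
  rw [ιMulti_pair_swap b a, ιMulti_pair_swap y x, h]

end LinearAlgebra

section InteriorProd

variable {V V' : Type*} [AddCommGroup V] [Module ℝ V] [TopologicalSpace V]
  [AddCommGroup V'] [Module ℝ V'] [TopologicalSpace V'] {k : ℕ}

lemma interiorProd_zero_right (X : V) : interiorProd X (0 : V [⋀^Fin k]→L[ℝ] ℝ) = 0 := by
  cases k <;> rfl

lemma interiorProd_zero_left (α : V [⋀^Fin k]→L[ℝ] ℝ) : interiorProd (0 : V) α = 0 := by
  cases k <;> simp [interiorProd]

lemma interiorProd_add_left (X Y : V) (α : V [⋀^Fin k]→L[ℝ] ℝ) :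
    interiorProd (X + Y) α = interiorProd X α + interiorProd Y α := by
  cases k <;> simp [interiorProd]

lemma interiorProd_smul_left (c : ℝ) (X : V) (α : V [⋀^Fin k]→L[ℝ] ℝ) :
    interiorProd (c • X) α = c • interiorProd X α := by
  cases k <;> simp [interiorProd]

lemma interiorProd_compContinuousLinearMap (X : V) (α : V' [⋀^Fin k]→L[ℝ] ℝ) (L : V →L[ℝ] V') :
    interiorProd X (α.compContinuousLinearMap L) =
      (interiorProd (L X) α).compLinearMap (L : V →ₗ[ℝ] V') := by
  cases k with
  | zero => rfl
  | succ k => exact AlternatingMap.curryLeft_compLinearMap L.toLinearMap α.toAlternatingMap X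

lemma interiorProd_eq_zero_of_mem_span {α : V [⋀^Fin k]→L[ℝ] ℝ} {a b x : V}
    (ha : interiorProd a α = 0) (hb : interiorProd b α = 0)
    (hx : x ∈ Submodule.span ℝ {a, b}) : interiorProd x α = 0 := by
  obtain ⟨c, d, rfl⟩ := Submodule.mem_span_pair.1 hx
  rw [interiorProd_add_left, interiorProd_smul_left, interiorProd_smul_left, ha, hb,
    smul_zero, smul_zero, add_zero]

end InteriorProd

section Immersion

variable {𝕜 : Type*} [NontriviallyNormedField 𝕜] {E₁ E₂ E₃ : Type*}
  [NormedAddCommGroup E₁] [NormedSpace 𝕜 E₁] [NormedAddCommGroup E₂] [NormedSpace 𝕜 E₂]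
  [NormedAddCommGroup E₃] [NormedSpace 𝕜 E₃]
  {H₁ H₂ H₃ : Type*} [TopologicalSpace H₁] [TopologicalSpace H₂] [TopologicalSpace H₃]
  {I : ModelWithCorners 𝕜 E₁ H₁} {J : ModelWithCorners 𝕜 E₂ H₂} {K : ModelWithCorners 𝕜 E₃ H₃}
  {N : Type*} [TopologicalSpace N] [ChartedSpace H₁ N]
  {P : Type*} [TopologicalSpace P] [ChartedSpace H₂ P]
  {Q : Type*} [TopologicalSpace Q] [ChartedSpace H₃ Q]
  {m : WithTop ℕ∞} {f : N → P} {φ : P → Q} {S : Set N} {x : N}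

lemma contMDiffWithinAt_of_comp_isImmersionAt (hφ : IsImmersionAt J K m φ (f x)) (hx : x ∈ S)
    (hf : ContinuousWithinAt f S x) (hφf : ContMDiffWithinAt I K m (φ ∘ f) S x) :
    ContMDiffWithinAt I J m f S x := by
  obtain ⟨C, _, _, h⟩ := hφ
  obtain ⟨t, ht, htS⟩ := mem_nhdsWithin_iff_exists_mem_nhds_inter.1 (hf.preimage_mem_nhdsWithin
    (h.domChart.open_source.mem_nhds h.mem_domChart_source))
  suffices ContMDiffWithinAt I J m f (t ∩ S) x from
    this.mono_of_mem_nhdsWithin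
      (Filter.inter_mem (mem_nhdsWithin_of_mem_nhds ht) self_mem_nhdsWithin)
  rw [contMDiffWithinAt_iff_of_mem_maximalAtlas' h.domChart_mem_maximalAtlas h.mem_domChart_source]
  refine ⟨hf.mono inter_subset_right, ?_⟩
  have hexpr := ((contMDiffWithinAt_iff_of_mem_maximalAtlas' (f := φ ∘ f)
    h.codChart_mem_maximalAtlas h.mem_codChart_source).1
    (hφf.mono (inter_subset_right : t ∩ S ⊆ S))).2
  have hproj : ContDiff 𝕜 m (Prod.fst ∘ h.equiv.symm : E₃ → E₂) :=
    contDiff_fst.comp h.equiv.symm.contDiff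
  have hmem : extChartAt I x x ∈ (extChartAt I x).symm ⁻¹' (t ∩ S) ∩ range I := by
    refine ⟨?_, extChartAt_target_subset_range x (mem_extChartAt_target x)⟩
    rw [mem_preimage, extChartAt_to_inv]
    exact ⟨mem_of_mem_nhds ht, hx⟩
  refine (hproj.comp_contDiffWithinAt hexpr).congr_of_mem (fun y hy => ?_) hmem
  have hsource : f ((extChartAt I x).symm y) ∈ (h.domChart.extend J).source := by
    rw [OpenPartialHomeomorph.extend_source]
    exact htS hy.1
  have hwritten := h.writtenInCharts ((h.domChart.extend J).map_source hsource)
  simp only [Function.comp_apply, (h.domChart.extend J).left_inv hsource] at hwritten ⊢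
  rw [hwritten, ContinuousLinearEquiv.symm_apply_apply]

end Immersion

section ImplicitFunction

variable {𝕜 : Type*} [RCLike 𝕜]
  {B : Type*} [NormedAddCommGroup B] [NormedSpace 𝕜 B] [CompleteSpace B]
  {H : Type*} [TopologicalSpace H] {I : ModelWithCorners 𝕜 B H} [I.Boundaryless]
  {N : Type*} [TopologicalSpace N] [ChartedSpace H N]
  {V : Type*} [NormedAddCommGroup V] [NormedSpace 𝕜 V] [CompleteSpace V]
  {V' : Type*} [NormedAddCommGroup V'] [NormedSpace 𝕜 V'] [CompleteSpace V']
  {m : WithTop ℕ∞} {f : N × V → V'} {x : N} {s : V}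

lemma exists_contMDiffAt_implicitFunction [IsManifold I m N] (hm : m ≠ 0)
    (hf : ContMDiffAt (I.prod 𝓘(𝕜, V)) 𝓘(𝕜, V') m f (x, s))
    (hd : (fderiv 𝕜 (fun t => f (x, t)) s).IsInvertible) :
    ∃ σ : N → V, ContMDiffAt I 𝓘(𝕜, V) m σ x ∧ σ x = s ∧ ∀ᶠ z in 𝓝 x, f (z, σ z) = f (x, s) := by
  set φ := extChartAt I x
  let g : B × V → V' := fun q => f (φ.symm q.1, q.2)
  have hφx : φ.symm (φ x) = x := φ.left_inv (mem_extChartAt_source x)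
  have hsymm : ContMDiffAt 𝓘(𝕜, B) I m φ.symm (φ x) := by
    simpa only [I.range_eq_univ, contMDiffWithinAt_univ] using
      contMDiffWithinAt_extChartAt_symm_range_self (I := I) (n := m) x
  have hg : ContDiffAt 𝕜 m g (φ x, s) := by
    refine contMDiffAt_iff_contDiffAt.1 (ContMDiffAt.comp_of_eq hf
      ((hsymm.comp (φ x, s) contDiffAt_fst.contMDiffAt).prodMk contDiffAt_snd.contMDiffAt) ?_)
    exact Prod.ext hφx rfl
  have hpartial : fderiv 𝕜 g (φ x, s) ∘L .inr 𝕜 B V = fderiv 𝕜 (fun t => f (x, t)) s := by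
    have hcomp : HasFDerivAt (fun t => g (φ x, t)) (fderiv 𝕜 g (φ x, s) ∘L .inr 𝕜 B V) s :=
      (hg.differentiableAt hm).hasFDerivAt.comp s (hasFDerivAt_prodMk_right _ _)
    simpa only [g, hφx] using hcomp.fderiv.symm
  rw [← hpartial] at hd
  refine ⟨hg.implicitFunction hm hd ∘ φ,
    (hg.contDiffAt_implicitFunction hm hd).contMDiffAt.comp x contMDiffAt_extChartAt,
    hg.implicitFunction_apply_self hm hd, ?_⟩
  filter_upwards [(continuousAt_extChartAt x).eventually
    (hg.eventually_apply_implicitFunction hm hd), extChartAt_source_mem_nhds (I := I) x]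
    with z hz hzs
  change f (φ.symm (φ z), _) = f (φ.symm (φ x), s) at hz
  rwa [φ.left_inv hzs, hφx] at hz

end ImplicitFunction

section VectorBundle

variable {𝕜 : Type*} [NontriviallyNormedField 𝕜]
  {B₀ : Type*} [NormedAddCommGroup B₀] [NormedSpace 𝕜 B₀]
  {H : Type*} [TopologicalSpace H] {I : ModelWithCorners 𝕜 B₀ H}
  {B : Type*} [TopologicalSpace B] [ChartedSpace H B]
  {F : Type*} [NormedAddCommGroup F] [NormedSpace 𝕜 F]
  {E : B → Type*} [∀ x, AddCommMonoid (E x)] [∀ x, Module 𝕜 (E x)]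
  [TopologicalSpace (Bundle.TotalSpace F E)] [∀ x, TopologicalSpace (E x)]
  [FiberBundle F E] [VectorBundle 𝕜 F E] [ContMDiffVectorBundle 1 F E I]

lemma eq_zero_of_mfderiv_trivialization_eq_zero
    (e : Bundle.Trivialization F (Bundle.TotalSpace.proj : Bundle.TotalSpace F E → B))
    [MemTrivializationAtlas e] {u : Bundle.TotalSpace F E} (hu : u.proj ∈ e.baseSet)
    {Z : TangentSpace (I.prod 𝓘(𝕜, F)) u}
    (hbase : mfderiv (I.prod 𝓘(𝕜, F)) I Bundle.TotalSpace.proj u Z = 0)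
    (hfiber : mfderiv (I.prod 𝓘(𝕜, F)) 𝓘(𝕜, F) (fun w => (e w).2) u Z = 0) : Z = 0 := by
  have hus : u ∈ e.source := e.mem_source.2 hu
  have he : e.toOpenPartialHomeomorph.MDifferentiable (I.prod 𝓘(𝕜, F)) (I.prod 𝓘(𝕜, F)) :=
    ⟨(e.contMDiffOn (IB := I) (n := 1)).mdifferentiableOn (by simp),
      (e.contMDiffOn_symm (IB := I) (n := 1)).mdifferentiableOn (by simp)⟩
  have hproj : MDifferentiableAt (I.prod 𝓘(𝕜, F)) I
      (Bundle.TotalSpace.proj : Bundle.TotalSpace F E → B) u :=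
    (Bundle.contMDiff_proj E (n := 1)).mdifferentiable (by simp) u
  have hsnd : MDifferentiableAt (I.prod 𝓘(𝕜, F)) 𝓘(𝕜, F) (fun w => (e w).2) u :=
    mdifferentiableAt_snd.comp u (he.mdifferentiableAt hus)
  have hsplit : (e : Bundle.TotalSpace F E → B × F) =ᶠ[𝓝 u] fun w => (w.proj, (e w).2) := by
    filter_upwards [e.open_source.mem_nhds hus] with w hw
    exact Prod.ext (e.coe_fst hw) rfl
  have hmfderiv := (hproj.hasMFDerivAt.prodMk hsnd.hasMFDerivAt).congr_of_eventuallyEq hsplit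
  exact he.mfderiv_injective hus ((DFunLike.congr_fun hmfderiv.mfderiv Z).trans
    ((Prod.ext hbase hfiber).trans (map_zero _).symm))

end VectorBundle

section BumpFunction

variable {B : Type*} [NormedAddCommGroup B] [NormedSpace ℝ B] [FiniteDimensional ℝ B]
  {H : Type*} [TopologicalSpace H] {I : ModelWithCorners ℝ B H}
  {N : Type*} [TopologicalSpace N] [T2Space N] [ChartedSpace H N] [IsManifold I ∞ N]
  {V : Type*} [NormedAddCommGroup V] [NormedSpace ℝ V]

lemma exists_contMDiff_eventuallyEq {p : N} {g : N → V}
    (hg : ContMDiffOn I 𝓘(ℝ, V) ∞ g (chartAt H p).source) :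
    ∃ h : N → V, ContMDiff I 𝓘(ℝ, V) ∞ h ∧ h =ᶠ[𝓝 p] g := by
  let f : SmoothBumpFunction I p := Classical.arbitrary _
  refine ⟨fun x => f x • g x, f.contMDiff_smul hg, ?_⟩
  filter_upwards [f.eventuallyEq_one] with x hx
  rw [hx, Pi.one_apply, one_smul]

end BumpFunction

section ScalarLift

variable {n : ℕ} {M : Type*} [TopologicalSpace M] [ChartedSpace (EuclideanSpace ℝ (Fin n)) M]

lemma scalarLift_scale (h : M → ℝ) (t : ℝ) (u : TangentBundle (𝓡 n) M) :
    scalarLift h (scale t u) = t * scalarLift h u :=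
  (mfderiv (𝓡 n) 𝓘(ℝ, ℝ) h u.proj).map_smul t u.snd

variable [IsManifold (𝓡 n) ∞ M]

lemma contMDiff_scalarLift {h : M → ℝ} (hh : ContMDiff (𝓡 n) 𝓘(ℝ, ℝ) ∞ h) :
    ContMDiff (𝓡 n).tangent 𝓘(ℝ, ℝ) ∞ (scalarLift h : TangentBundle (𝓡 n) M → ℝ) := by
  intro u
  refine (Bundle.contMDiffAt_totalSpace.1
    (hh.contMDiff_tangentMap (m := ∞) (by simp) u)).2.congr_of_eventuallyEq (.of_forall fun w => ?_)
  simp only [tangentMap, trivializationAt_model_space_apply]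
  rfl

/-- The fibre coordinate on `TM` in the preferred trivialization at the point `p` of `M`. -/
def fiberCoord (p : M) (w : TangentBundle (𝓡 n) M) : EuclideanSpace ℝ (Fin n) :=
  (trivializationAt (EuclideanSpace ℝ (Fin n)) (TangentSpace (𝓡 n) : M → Type _) p w).2

lemma fiberCoord_eq_mfderiv {p : M} {w : TangentBundle (𝓡 n) M}
    (hw : w.proj ∈ (chartAt (EuclideanSpace ℝ (Fin n)) p).source) :
    fiberCoord p w = mfderiv (𝓡 n) (𝓡 n) (extChartAt (𝓡 n) p) w.proj w.snd := by
  have hbase : w.proj ∈ (trivializationAt (EuclideanSpace ℝ (Fin n))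
      (TangentSpace (𝓡 n) : M → Type _) p).baseSet := hw
  exact (congrFun (Bundle.Trivialization.coe_linearMapAt_of_mem (R := ℝ) _ hbase) w.snd).symm.trans
    (DFunLike.congr_fun (TangentBundle.continuousLinearMapAt_trivializationAt (I := 𝓡 n) hw) w.snd)

lemma mdifferentiableAt_fiberCoord (u : TangentBundle (𝓡 n) M) :
    MDifferentiableAt (𝓡 n).tangent 𝓘(ℝ, EuclideanSpace ℝ (Fin n)) (fiberCoord u.proj) u :=
  (Bundle.contMDiffAt_totalSpace.1
    (contMDiffAt_id (I := (𝓡 n).tangent) (n := ∞) (x := u))).2.mdifferentiableAt (by simp)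

lemma fiberCoord_proj_ne_zero {u : TangentBundle (𝓡 n) M} (hu : u.snd ≠ 0) :
    fiberCoord u.proj u ≠ 0 := fun h =>
  hu (((trivializationAt (EuclideanSpace ℝ (Fin n)) (TangentSpace (𝓡 n) : M → Type _)
    u.proj).continuousLinearEquivAt ℝ u.proj
      (FiberBundle.mem_baseSet_trivializationAt' u.proj)).map_eq_zero_iff.1 h)

variable [T2Space M]

lemma exists_scalarLift_eventuallyEq (u : TangentBundle (𝓡 n) M)
    (ℓ : EuclideanSpace ℝ (Fin n) →L[ℝ] ℝ) :
    ∃ h : M → ℝ, ContMDiff (𝓡 n) 𝓘(ℝ, ℝ) ∞ h ∧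
      scalarLift h =ᶠ[𝓝 u] fun w => ℓ (fiberCoord u.proj w) := by
  obtain ⟨h, hh, hhℓ⟩ := exists_contMDiff_eventuallyEq (p := u.proj)
    (ℓ.contMDiff.comp_contMDiffOn (contMDiffOn_extChartAt (I := 𝓡 n) (n := ∞)))
  refine ⟨h, hh, ?_⟩
  have hproj : ContinuousAt (Bundle.TotalSpace.proj : TangentBundle (𝓡 n) M → M) u :=
    (FiberBundle.continuous_proj (EuclideanSpace ℝ (Fin n))
      (TangentSpace (𝓡 n) : M → Type _)).continuousAt
  filter_upwards [hproj.eventually hhℓ.eventuallyEq_nhds,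
    hproj.eventually (chart_source_mem_nhds (EuclideanSpace ℝ (Fin n)) u.proj)] with w hw hws
  have hchain := (ℓ.hasMFDerivAt (x := extChartAt (𝓡 n) u.proj w.proj)).comp w.proj
    (mdifferentiableAt_extChartAt (I := 𝓡 n) hws).hasMFDerivAt
  rw [fiberCoord_eq_mfderiv hws]
  exact DFunLike.congr_fun (hw.mfderiv_eq.trans hchain.mfderiv) w.snd

lemma exists_scalarLift_ne_zero {u : TangentBundle (𝓡 n) M} (hu : u.snd ≠ 0) :
    ∃ h : M → ℝ, ContMDiff (𝓡 n) 𝓘(ℝ, ℝ) ∞ h ∧ scalarLift h u ≠ 0 := by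
  obtain ⟨ℓ, hℓ⟩ := SeparatingDual.exists_ne_zero (R := ℝ) (fiberCoord_proj_ne_zero hu)
  obtain ⟨h, hh, hhℓ⟩ := exists_scalarLift_eventuallyEq u ℓ
  exact ⟨h, hh, hhℓ.eq_of_nhds ▸ hℓ⟩

lemma eq_zero_of_dirDeriv_scalarLift_eq_zero {u : TangentBundle (𝓡 n) M}
    {Z : TangentSpace (𝓡 n).tangent u}
    (hproj : mfderiv (𝓡 n).tangent (𝓡 n)
      (Bundle.TotalSpace.proj : TangentBundle (𝓡 n) M → M) u Z = 0)
    (hlift : ∀ h : M → ℝ, ContMDiff (𝓡 n) 𝓘(ℝ, ℝ) ∞ h → dirDeriv (scalarLift h) u Z = 0) :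
    Z = 0 := by
  refine eq_zero_of_mfderiv_trivialization_eq_zero
    (trivializationAt (EuclideanSpace ℝ (Fin n)) (TangentSpace (𝓡 n) : M → Type _) u.proj)
    (FiberBundle.mem_baseSet_trivializationAt' u.proj) hproj ?_
  refine SeparatingDual.eq_zero_of_forall_dual_eq_zero (R := ℝ) (V := EuclideanSpace ℝ (Fin n))
    fun ℓ => ?_
  obtain ⟨h, hh, hhℓ⟩ := exists_scalarLift_eventuallyEq u ℓ
  have hchain := (ℓ.hasMFDerivAt (x := fiberCoord u.proj u)).comp u
    (mdifferentiableAt_fiberCoord u).hasMFDerivAt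
  exact (DFunLike.congr_fun (hhℓ.mfderiv_eq.trans hchain.mfderiv) Z).symm.trans (hlift h hh)

end ScalarLift

section Radial

variable {n : ℕ} {M : Type*} [TopologicalSpace M]
  [ChartedSpace (EuclideanSpace ℝ (Fin n)) M] [IsManifold (𝓡 n) ∞ M]

lemma mdifferentiable_proj : MDifferentiable (𝓡 n).tangent (𝓡 n)
    (Bundle.TotalSpace.proj : TangentBundle (𝓡 n) M → M) :=
  (Bundle.contMDiff_proj (TangentSpace (𝓡 n) : M → Type _) (n := 1)).mdifferentiable (by simp)

lemma hasMFDerivWithinAt_comp_scale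
    {G : Type*} [NormedAddCommGroup G] [NormedSpace ℝ G]
    {H : Type*} [TopologicalSpace H] {K : ModelWithCorners ℝ G H}
    {P : Type*} [TopologicalSpace P] [ChartedSpace H P] {F : TangentBundle (𝓡 n) M → P}
    {S : Set (TangentBundle (𝓡 n) M)} {u : TangentBundle (𝓡 n) M} {T : Set ℝ}
    {F' : EuclideanSpace ℝ (Fin n) × EuclideanSpace ℝ (Fin n) →L[ℝ] G}
    (hF : HasMFDerivWithinAt (𝓡 n).tangent K F S u F') (hT : ∀ t ∈ T, scale t u ∈ S) :
    HasMFDerivWithinAt 𝓘(ℝ, ℝ) K (fun t : ℝ => F (scale t u)) T 1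
      (F' ∘L (mfderiv 𝓘(ℝ, ℝ) (𝓡 n).tangent (fun t : ℝ => scale t u) 1 :
        ℝ →L[ℝ] EuclideanSpace ℝ (Fin n) × EuclideanSpace ℝ (Fin n))) := by
  have hF_one : ∀ q, q = u → HasMFDerivWithinAt (𝓡 n).tangent K F S q F' := by
    rintro q rfl
    exact hF
  exact (hF_one _ (scale_one u)).comp (1 : ℝ) (hasMFDerivAt_scale u).hasMFDerivWithinAt hT

lemma hasDerivAt_comp_scale {F : TangentBundle (𝓡 n) M → ℝ} {u : TangentBundle (𝓡 n) M}
    (hF : MDifferentiableAt (𝓡 n).tangent 𝓘(ℝ, ℝ) F u) :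
    HasDerivAt (fun t : ℝ => F (scale t u)) (dirDeriv F u (radialField u)) 1 := by
  let F' : EuclideanSpace ℝ (Fin n) × EuclideanSpace ℝ (Fin n) →L[ℝ] ℝ :=
    mfderiv (𝓡 n).tangent 𝓘(ℝ, ℝ) F u
  have hcomp := hasMFDerivWithinAt_comp_scale (T := univ) (F' := F')
    hF.hasMFDerivAt.hasMFDerivWithinAt (fun _ _ => mem_univ _)
  have hcomp' : HasFDerivAt (fun t : ℝ => F (scale t u))
      (F' ∘L (mfderiv 𝓘(ℝ, ℝ) (𝓡 n).tangent (fun t : ℝ => scale t u) 1 :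
        ℝ →L[ℝ] EuclideanSpace ℝ (Fin n) × EuclideanSpace ℝ (Fin n))) 1 :=
    hasMFDerivAt_iff_hasFDerivAt.1 (hasMFDerivWithinAt_univ.1 hcomp)
  exact hcomp'.hasDerivAt

lemma mfderiv_proj_radialField (u : TangentBundle (𝓡 n) M) :
    mfderiv (𝓡 n).tangent (𝓡 n) (Bundle.TotalSpace.proj : TangentBundle (𝓡 n) M → M) u
      (radialField u) = 0 := by
  have hcomp := hasMFDerivWithinAt_univ.1 (hasMFDerivWithinAt_comp_scale (T := univ)
    (mdifferentiable_proj u).hasMFDerivAt.hasMFDerivWithinAt (fun _ _ => mem_univ _))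
  exact DFunLike.congr_fun (hasMFDerivAt_unique hcomp (hasMFDerivAt_const u.proj (1 : ℝ))) 1

lemma dirDeriv_scalarLift_radialField {h : M → ℝ} (hh : ContMDiff (𝓡 n) 𝓘(ℝ, ℝ) ∞ h)
    (u : TangentBundle (𝓡 n) M) :
    dirDeriv (scalarLift h) u (radialField u) = scalarLift h u := by
  have hray : HasDerivAt (fun t : ℝ => scalarLift h (scale t u)) (scalarLift h u) 1 := by
    simp only [scalarLift_scale]
    exact hasDerivAt_mul_const (scalarLift h u)
  exact (hasDerivAt_comp_scale ((contMDiff_scalarLift hh).mdifferentiable (by simp) u)).unique hray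

lemma linearIndependent_radialField [T2Space M] {u : TangentBundle (𝓡 n) M} (hu : u.snd ≠ 0)
    {Z : TangentSpace (𝓡 n).tangent u}
    (hZ : mfderiv (𝓡 n).tangent (𝓡 n) (Bundle.TotalSpace.proj : TangentBundle (𝓡 n) M → M) u Z
      = u.snd) :
    LinearIndependent ℝ ![radialField u, Z] := by
  refine LinearIndependent.pair_iff.2 fun a b hab => ?_
  have hb : b = 0 := by
    have hproj := congrArg (mfderiv (𝓡 n).tangent (𝓡 n)
      (Bundle.TotalSpace.proj : TangentBundle (𝓡 n) M → M) u) hab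
    rw [map_add, map_smul, map_smul, mfderiv_proj_radialField, hZ, map_zero, smul_zero,
      zero_add] at hproj
    exact (smul_eq_zero.1 hproj).resolve_right hu
  have ha : a = 0 := by
    obtain ⟨h, hh, hhu⟩ := exists_scalarLift_ne_zero hu
    have hlift := congrArg (mfderiv (𝓡 n).tangent 𝓘(ℝ, ℝ) (scalarLift h) u) hab
    rw [hb, zero_smul, add_zero, map_smul, map_zero] at hlift
    exact (smul_eq_zero.1 ((congrArg (a • ·) (dirDeriv_scalarLift_radialField hh u)).symm.trans
      hlift)).resolve_right hhu
  exact ⟨ha, hb⟩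

lemma mfderiv_proj_mfderiv_scale (t : ℝ) (u : TangentBundle (𝓡 n) M)
    (X : TangentSpace (𝓡 n).tangent u) :
    mfderiv (𝓡 n).tangent (𝓡 n) (Bundle.TotalSpace.proj : TangentBundle (𝓡 n) M → M) (scale t u)
        (mfderiv (𝓡 n).tangent (𝓡 n).tangent (scale t) u X) =
      mfderiv (𝓡 n).tangent (𝓡 n)
        (Bundle.TotalSpace.proj : TangentBundle (𝓡 n) M → M) u X := by
  have hcomp := (mdifferentiable_proj (scale t u)).hasMFDerivAt.comp u
    ((contMDiff_scale_left t).mdifferentiable (by simp) u).hasMFDerivAt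
  exact DFunLike.congr_fun (hasMFDerivAt_unique hcomp (mdifferentiable_proj u).hasMFDerivAt) X

lemma dirDeriv_scalarLift_mfderiv_scale {h : M → ℝ} (hh : ContMDiff (𝓡 n) 𝓘(ℝ, ℝ) ∞ h) (t : ℝ)
    (u : TangentBundle (𝓡 n) M) (X : TangentSpace (𝓡 n).tangent u) :
    dirDeriv (scalarLift h) (scale t u) (mfderiv (𝓡 n).tangent (𝓡 n).tangent (scale t) u X) =
      t * dirDeriv (scalarLift h) u X := by
  have hlift := (contMDiff_scalarLift hh).mdifferentiable (by simp)
  have hcomp := (hlift (scale t u)).hasMFDerivAt.comp u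
    ((contMDiff_scale_left t).mdifferentiable (by simp) u).hasMFDerivAt
  have hsmul : HasMFDerivAt (𝓡 n).tangent 𝓘(ℝ, ℝ) (fun w => t * scalarLift h w) u
      (t • mfderiv (𝓡 n).tangent 𝓘(ℝ, ℝ) (scalarLift h) u) := (hlift u).hasMFDerivAt.const_smul t
  exact DFunLike.congr_fun (hasMFDerivAt_unique hcomp
    (hsmul.congr_of_eventuallyEq (.of_forall fun w => scalarLift_scale h t w))) X

lemma IsVlasovField.scale_eq [T2Space M] {U : Set (TangentBundle (𝓡 n) M)}
    {W : VField (𝓡 n).tangent (TangentBundle (𝓡 n) M)} (hW : IsVlasovField U W)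
    {u : TangentBundle (𝓡 n) M} {t : ℝ} (hu : u ∈ U) (ht : 0 < t) (htu : scale t u ∈ U) :
    W (scale t u) = t • mfderiv (𝓡 n).tangent (𝓡 n).tangent (scale t) u (W u) := by
  refine sub_eq_zero.1 (eq_zero_of_dirDeriv_scalarLift_eq_zero ?_ fun h hh => ?_)
  · rw [map_sub, map_smul, mfderiv_proj_mfderiv_scale, hW.horizontal u hu, hW.horizontal _ htu]
    exact sub_self (t • u.snd)
  · rw [dirDeriv, map_sub, map_smul]
    change dirDeriv (scalarLift h) (scale t u) (W (scale t u)) - t * dirDeriv (scalarLift h)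
      (scale t u) (mfderiv (𝓡 n).tangent (𝓡 n).tangent (scale t) u (W u)) = 0
    rw [dirDeriv_scalarLift_mfderiv_scale hh, hW.quadratic h hh u hu t ht]
    ring

lemma exists_contMDiffAt_scale_apply_eq {F : TangentBundle (𝓡 n) M → ℝ}
    {u : TangentBundle (𝓡 n) M} (hF : ContMDiffAt (𝓡 n).tangent 𝓘(ℝ, ℝ) ∞ F u)
    (hdF : dirDeriv F u (radialField u) ≠ 0) :
    ∃ σ : TangentBundle (𝓡 n) M → ℝ, ContMDiffAt (𝓡 n).tangent 𝓘(ℝ, ℝ) ∞ σ u ∧ σ u = 1 ∧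
      ∀ᶠ z in 𝓝 u, F (scale (σ z) z) = F u := by
  have hswap : ContMDiff ((𝓡 n).tangent.prod 𝓘(ℝ, ℝ)) (𝓡 n).tangent ∞
      (fun q : TangentBundle (𝓡 n) M × ℝ => scale q.2 q.1) :=
    contMDiff_scale.comp (contMDiff_snd.prodMk contMDiff_fst)
  have hderiv := (hasDerivAt_comp_scale (hF.mdifferentiableAt (by simp))).hasFDerivAt.fderiv
  obtain ⟨σ, hσ, hσu, hσF⟩ := exists_contMDiffAt_implicitFunction (by simp)
    (hF.comp_of_eq (hswap (u, 1)) (scale_one u))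
    (hderiv ▸ ⟨ContinuousLinearEquiv.unitsEquivAut ℝ (Units.mk0 _ hdF), by ext; simp⟩)
  exact ⟨σ, hσ, hσu, hσF.mono fun z hz => hz.trans (congrArg F (scale_one u))⟩

end Radial

section Orientation

variable {n : ℕ} {M : Type*} [TopologicalSpace M]
  [ChartedSpace (EuclideanSpace ℝ (Fin n)) M]

lemma causalIndicator_pos_iff {Up : Set (TangentBundle (𝓡 n) M)} {u : TangentBundle (𝓡 n) M} :
    0 < causalIndicator Up u ↔ u ∈ Up := by
  by_cases hu : u ∈ Up <;> simp [causalIndicator, hu]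

lemma causalIndicator_neg_iff {Up : Set (TangentBundle (𝓡 n) M)} {u : TangentBundle (𝓡 n) M} :
    causalIndicator Up u < 0 ↔ u ∉ Up := by
  by_cases hu : u ∈ Up <;> simp [causalIndicator, hu]

lemma causalIndicator_ne_zero (Up : Set (TangentBundle (𝓡 n) M)) (u : TangentBundle (𝓡 n) M) :
    causalIndicator Up u ≠ 0 := by
  by_cases hu : u ∈ Up <;> simp [causalIndicator, hu]

namespace IsTimeOrientation

variable [IsManifold (𝓡 n) ∞ M] {U Up Um : Set (TangentBundle (𝓡 n) M)}
  {u : TangentBundle (𝓡 n) M}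

lemma future_subset (hor : IsTimeOrientation U Up Um) : Up ⊆ U :=
  hor.union_eq ▸ subset_union_left

lemma future_mem_nhdsWithin (hor : IsTimeOrientation U Up Um) (hu : u ∈ Up) : Up ∈ 𝓝[U] u := by
  filter_upwards [(hor.smooth_indicator.continuousOn u (hor.future_subset hu)).eventually
    (lt_mem_nhds (causalIndicator_pos_iff.2 hu))] with w hw using causalIndicator_pos_iff.1 hw

lemma compl_future_mem_nhdsWithin (hor : IsTimeOrientation U Up Um) (huU : u ∈ U) (hu : u ∉ Up) :
    Upᶜ ∈ 𝓝[U] u := by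
  filter_upwards [(hor.smooth_indicator.continuousOn u huU).eventually
    (gt_mem_nhds (causalIndicator_neg_iff.2 hu))] with w hw using causalIndicator_neg_iff.1 hw

lemma scale_mem_future (hor : IsTimeOrientation U Up Um) (hU : IsConicSubbundle U) (hu : u ∈ Up)
    {t : ℝ} (ht : 0 < t) : scale t u ∈ Up := by
  by_contra htu
  have hcont : ContinuousOn (fun s : ℝ => causalIndicator Up (scale s u)) (Ioi 0) :=
    hor.smooth_indicator.continuousOn.comp (contMDiff_scale_right u).continuous.continuousOn
      fun s hs => hU.conic u (hor.future_subset hu) s (ne_of_gt hs)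
  obtain ⟨s, -, hs⟩ := isPreconnected_Ioi.intermediate_value (mem_Ioi.2 ht)
    (mem_Ioi.2 (zero_lt_one (α := ℝ))) hcont ⟨(causalIndicator_neg_iff.2 htu).le,
      (causalIndicator_pos_iff.2 ((scale_one u).symm ▸ hu)).le⟩
  exact causalIndicator_ne_zero Up _ hs

lemma eventuallyEq_future (hor : IsTimeOrientation U Up Um) (hu : u ∈ Up) : U =ᶠ[𝓝 u] Up := by
  filter_upwards [mem_nhdsWithin_iff_eventually.1 (hor.future_mem_nhdsWithin hu)] with w hw
  exact propext ⟨hw, fun h => hor.future_subset h⟩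

lemma uniqueMDiffOn_future (hor : IsTimeOrientation U Up Um) (hU : IsConicSubbundle U) :
    UniqueMDiffOn (𝓡 n).tangent Up := fun u hu =>
  ((hU.uniqueDiff u (hor.future_subset hu)).inter' (hor.future_mem_nhdsWithin hu)).mono
    inter_subset_right

lemma future_subset_closure_interior (hor : IsTimeOrientation U Up Um) (hU : IsConicSubbundle U) :
    Up ⊆ closure (interior Up) := by
  intro u hu
  obtain ⟨O, hO, huO, hOU⟩ := mem_nhdsWithin.1 (hor.future_mem_nhdsWithin hu)
  have hsub : O ∩ interior U ⊆ interior Up :=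
    interior_maximal ((inter_subset_inter_right O interior_subset).trans hOU)
      (hO.inter isOpen_interior)
  exact closure_mono hsub (hO.inter_closure
    ⟨huO, hU.subset_closure_interior (hor.future_subset hu)⟩)

end IsTimeOrientation

end Orientation

section KinematicDomain

variable {n : ℕ} {M : Type*} [TopologicalSpace M]
  [ChartedSpace (EuclideanSpace ℝ (Fin n)) M] [IsManifold (𝓡 n) ∞ M]
  {U Up Um : Set (TangentBundle (𝓡 n) M)}
  {H : Type*} [TopologicalSpace H]
  {J : ModelWithCorners ℝ (EuclideanSpace ℝ (Fin (2 * n - 1))) H}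
  {E : Type*} [TopologicalSpace E] [ChartedSpace H E]
  {ιE : E → TangentBundle (𝓡 n) M}

namespace IsKinematicDomain

lemma exists_pos_scale (hE : IsKinematicDomain J U Up ιE) (hor : IsTimeOrientation U Up Um)
    (hU : IsConicSubbundle U) {u : TangentBundle (𝓡 n) M} (hu : u ∈ Up) :
    ∃ v : E, ∃ t : ℝ, 0 < t ∧ u = scale t (ιE v) := by
  obtain ⟨⟨v, t⟩, ⟨ht, rfl⟩, -⟩ := hE.ray u (hor.future_subset hu)
  refine ⟨v, t, ht.lt_or_gt.resolve_left fun hneg => ?_, rfl⟩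
  have hpast := (hor.neg_iff _).1 (hor.scale_mem_future hU (hE.mem_future v) (neg_pos.2 hneg))
  rw [scale_scale, neg_mul_neg, one_mul] at hpast
  exact hor.disj.notMem_of_mem_left hu hpast

variable [Nonempty E]

lemma radialProj_scale (hE : IsKinematicDomain J U Up ιE) (hor : IsTimeOrientation U Up Um)
    (hU : IsConicSubbundle U) (v : E) {t : ℝ} (ht : 0 < t) :
    radialProj ιE (scale t (ιE v)) = v := by
  obtain ⟨s, hs, hst⟩ := Classical.epsilon_spec
    (p := fun v' => ∃ s : ℝ, 0 < s ∧ scale t (ιE v) = scale s (ιE v')) ⟨v, t, ht, rfl⟩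
  have hmem := hor.future_subset (hor.scale_mem_future hU (hE.mem_future v) ht)
  exact congrArg Prod.fst ((hE.ray _ hmem).unique
    (y₁ := (radialProj ιE (scale t (ιE v)), s)) (y₂ := (v, t)) ⟨hs.ne', hst⟩ ⟨ht.ne', rfl⟩)

lemma radialProj_apply (hE : IsKinematicDomain J U Up ιE) (hor : IsTimeOrientation U Up Um)
    (hU : IsConicSubbundle U) (v : E) : radialProj ιE (ιE v) = v :=
  (congrArg _ (scale_one _).symm).trans (hE.radialProj_scale hor hU v one_pos)

lemma radialProj_scale_of_mem (hE : IsKinematicDomain J U Up ιE) (hor : IsTimeOrientation U Up Um)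
    (hU : IsConicSubbundle U) {u : TangentBundle (𝓡 n) M} (hu : u ∈ Up) {t : ℝ} (ht : 0 < t) :
    radialProj ιE (scale t u) = radialProj ιE u := by
  obtain ⟨v, s, hs, rfl⟩ := hE.exists_pos_scale hor hU hu
  rw [scale_scale, hE.radialProj_scale hor hU v (mul_pos ht hs), hE.radialProj_scale hor hU v hs]

lemma apply_radialProj_of_scale_mem_range (hE : IsKinematicDomain J U Up ιE)
    (hor : IsTimeOrientation U Up Um) (hU : IsConicSubbundle U) {u : TangentBundle (𝓡 n) M}
    (hu : u ∈ Up) {t : ℝ} (ht : 0 < t) (htu : scale t u ∈ range ιE) :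
    ιE (radialProj ιE u) = scale t u := by
  obtain ⟨v, hv⟩ := htu
  rw [← hE.radialProj_scale_of_mem hor hU hu ht, ← hv, hE.radialProj_apply hor hU]

lemma exists_contMDiffAt_apply_radialProj_eq_scale (hE : IsKinematicDomain J U Up ιE)
    (hor : IsTimeOrientation U Up Um) (hU : IsConicSubbundle U) (v : E) :
    ∃ σ : TangentBundle (𝓡 n) M → ℝ, ContMDiffAt (𝓡 n).tangent 𝓘(ℝ, ℝ) ∞ σ (ιE v) ∧
      ∀ᶠ z in 𝓝[Up] (ιE v), ιE (radialProj ιE z) = scale (σ z) z := by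
  obtain ⟨O, hO, hvO, F, hF, hrange, hdF⟩ := hE.hypersurface v
  have hFv : F (ιE v) = 0 := (hrange.subset ⟨mem_range_self v, hvO⟩).2
  obtain ⟨σ, hσ, hσv, hσF⟩ :=
    exists_contMDiffAt_scale_apply_eq (hF.contMDiffAt (hO.mem_nhds hvO)) hdF
  have hpos : ∀ᶠ z in 𝓝 (ιE v), 0 < σ z :=
    hσ.continuousAt.eventually (lt_mem_nhds (hσv ▸ one_pos))
  have hscale : ContinuousAt (fun z => scale (σ z) z) (ιE v) :=
    contMDiff_scale.continuous.continuousAt.comp (hσ.continuousAt.prodMk continuousAt_id)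
  have hmem : ∀ᶠ z in 𝓝 (ιE v), scale (σ z) z ∈ O :=
    hscale.eventually (hO.mem_nhds (by simpa only [hσv, scale_one] using hvO))
  refine ⟨σ, hσ, ?_⟩
  filter_upwards [nhdsWithin_le_nhds hpos, nhdsWithin_le_nhds hmem, nhdsWithin_le_nhds hσF,
    self_mem_nhdsWithin] with z hzpos hzO hzF hz
  have hzU : scale (σ z) z ∈ U := hU.conic z (hor.future_subset hz) _ (ne_of_gt hzpos)
  exact hE.apply_radialProj_of_scale_mem_range hor hU hz hzpos
    (hrange.superset ⟨⟨hzU, hzO⟩, hzF.trans hFv⟩).1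

lemma contMDiffWithinAt_radialProj (hE : IsKinematicDomain J U Up ιE)
    (hor : IsTimeOrientation U Up Um) (hU : IsConicSubbundle U) (v : E) :
    ContMDiffWithinAt (𝓡 n).tangent J ∞ (radialProj ιE) Up (ιE v) := by
  obtain ⟨σ, hσ, hσE⟩ := hE.exists_contMDiffAt_apply_radialProj_eq_scale hor hU v
  have hscale : ContMDiffAt (𝓡 n).tangent (𝓡 n).tangent ∞ (fun z => scale (σ z) z) (ιE v) :=
    contMDiff_scale.contMDiffAt.comp (ιE v) (hσ.prodMk contMDiffAt_id)
  have hcomp : ContMDiffWithinAt (𝓡 n).tangent (𝓡 n).tangent ∞ (ιE ∘ radialProj ιE) Up (ιE v) :=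
    hscale.contMDiffWithinAt.congr_of_eventuallyEq hσE
      (hσE.self_of_nhdsWithin (hE.mem_future v))
  exact contMDiffWithinAt_of_comp_isImmersionAt (hE.embedding.isImmersion.isImmersionAt _)
    (hE.mem_future v)
    (hE.embedding.isEmbedding.isInducing.continuousWithinAt_iff.2 hcomp.continuousWithinAt) hcomp

lemma contMDiffOn_radialProj (hE : IsKinematicDomain J U Up ιE)
    (hor : IsTimeOrientation U Up Um) (hU : IsConicSubbundle U) :
    ContMDiffOn (𝓡 n).tangent J ∞ (radialProj ιE) Up := by
  intro u hu
  obtain ⟨v, t, ht, rfl⟩ := hE.exists_pos_scale hor hU hu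
  have hinv : scale t⁻¹ (scale t (ιE v)) = ιE v := by
    rw [scale_scale, inv_mul_cancel₀ ht.ne', scale_one]
  have hproj_scale : ∀ w ∈ Up, radialProj ιE w = radialProj ιE (scale t⁻¹ w) := fun w hw =>
    (hE.radialProj_scale_of_mem hor hU hw (inv_pos.2 ht)).symm
  have hv := hE.contMDiffWithinAt_radialProj hor hU v
  rw [← hinv] at hv
  exact (hv.comp (scale t (ιE v)) (contMDiff_scale_left t⁻¹).contMDiffAt.contMDiffWithinAt
    fun w hw => hor.scale_mem_future hU hw (inv_pos.2 ht)).congr hproj_scale (hproj_scale _ hu)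

lemma hasMFDerivWithinAt_radialProj (hE : IsKinematicDomain J U Up ιE)
    (hor : IsTimeOrientation U Up Um) (hU : IsConicSubbundle U) {u : TangentBundle (𝓡 n) M}
    (hu : u ∈ Up) : HasMFDerivWithinAt (𝓡 n).tangent J (radialProj ιE) Up u
      (mfderivWithin (𝓡 n).tangent J (radialProj ιE) Up u) :=
  ((hE.contMDiffOn_radialProj hor hU u hu).mdifferentiableWithinAt (by simp)).hasMFDerivWithinAt

lemma mfderivWithin_radialProj_radialField (hE : IsKinematicDomain J U Up ιE)
    (hor : IsTimeOrientation U Up Um) (hU : IsConicSubbundle U) {u : TangentBundle (𝓡 n) M}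
    (hu : u ∈ Up) :
    mfderivWithin (𝓡 n).tangent J (radialProj ιE) Up u (radialField u) = 0 := by
  have hcomp := (hasMFDerivWithinAt_comp_scale (T := Ioi 0)
    (hE.hasMFDerivWithinAt_radialProj hor hU hu)
    fun t ht => hor.scale_mem_future hU hu ht).hasMFDerivAt (Ioi_mem_nhds one_pos)
  have hconst : HasMFDerivAt 𝓘(ℝ, ℝ) J (fun t : ℝ => radialProj ιE (scale t u)) 1 0 :=
    (hasMFDerivAt_const (radialProj ιE u) (1 : ℝ)).congr_of_eventuallyEq
      ((eventually_gt_nhds one_pos).mono fun t ht => hE.radialProj_scale_of_mem hor hU hu ht)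
  exact DFunLike.congr_fun (hasMFDerivAt_unique hcomp hconst) (1 : ℝ)

lemma mfderivWithin_radialProj_mfderiv_scale (hE : IsKinematicDomain J U Up ιE)
    (hor : IsTimeOrientation U Up Um) (hU : IsConicSubbundle U) {v : E} {t : ℝ} (ht : 0 < t)
    (X : TangentSpace J v) :
    (mfderivWithin (𝓡 n).tangent J (radialProj ιE) Up (scale t (ιE v))
      (mfderiv (𝓡 n).tangent (𝓡 n).tangent (scale t) (ιE v)
        (mfderiv J (𝓡 n).tangent ιE v X)) : EuclideanSpace ℝ (Fin (2 * n - 1))) = X := by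
  have hι := (hE.embedding.contMDiff.mdifferentiable (by simp) v).hasMFDerivAt
  have hscale := ((contMDiff_scale_left t).mdifferentiable (by simp) (ιE v)).hasMFDerivAt
  have hcomp := (hE.hasMFDerivWithinAt_radialProj hor hU
    (hor.scale_mem_future hU (hE.mem_future v) ht)).comp v
      (hscale.comp v hι).hasMFDerivWithinAt (s := univ)
      fun w _ => hor.scale_mem_future hU (hE.mem_future w) ht
  have hid := (hasMFDerivAt_id (I := J) v).congr_of_eventuallyEq
    (f₁ := radialProj ιE ∘ scale t ∘ ιE) (.of_forall fun w => hE.radialProj_scale hor hU w ht)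
  exact DFunLike.congr_fun (hasMFDerivAt_unique (hasMFDerivWithinAt_univ.1 hcomp) hid) X

lemma mfderivWithin_radialProj_extension [T2Space M] [IsManifold J ∞ E]
    (hE : IsKinematicDomain J U Up ιE) (hor : IsTimeOrientation U Up Um)
    (hU : IsConicSubbundle U) {WE : VField J E}
    {W : VField (𝓡 n).tangent (TangentBundle (𝓡 n) M)} (hW : IsExtension U ιE WE W)
    (v : E) {t : ℝ} (ht : 0 < t) :
    (mfderivWithin (𝓡 n).tangent J (radialProj ιE) Up (scale t (ιE v)) (W (scale t (ιE v))) :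
      EuclideanSpace ℝ (Fin (2 * n - 1))) = t • (WE v : EuclideanSpace ℝ (Fin (2 * n - 1))) := by
  have hv := hE.mem_future v
  rw [hW.vlasov.scale_eq (hor.future_subset hv) ht
    (hor.future_subset (hor.scale_mem_future hU hv ht)), map_smul, ← hW.induced v]
  exact congrArg (fun X : EuclideanSpace ℝ (Fin (2 * n - 1)) => t • X)
    (hE.mfderivWithin_radialProj_mfderiv_scale hor hU ht (WE v))

end IsKinematicDomain

end KinematicDomain

section FutureForm

variable {n : ℕ} {M : Type*} [TopologicalSpace M]
  [ChartedSpace (EuclideanSpace ℝ (Fin n)) M] [IsManifold (𝓡 n) ∞ M]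
  {U Up Um : Set (TangentBundle (𝓡 n) M)}
  {H : Type*} [TopologicalSpace H]
  {J : ModelWithCorners ℝ (EuclideanSpace ℝ (Fin (2 * n - 1))) H}
  {E : Type*} [TopologicalSpace E] [ChartedSpace H E] [Nonempty E]
  {ιE : E → TangentBundle (𝓡 n) M} {k : ℕ} {θE : DForm J E k} {u : TangentBundle (𝓡 n) M}

lemma futureForm_of_mem (hu : u ∈ Up) :
    futureForm Up ιE θE u = pullbackForm (𝓡 n).tangent Up (radialProj ιE) θE u :=
  if_pos hu

lemma futureForm_of_notMem (hu : u ∉ Up) : futureForm Up ιE θE u = 0 :=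
  if_neg hu

lemma interiorProd_futureForm_eq_zero {X : TangentSpace (𝓡 n).tangent u}
    (hX : u ∈ Up → interiorProd
      (mfderivWithin (𝓡 n).tangent J (radialProj ιE) Up u X) (θE (radialProj ιE u)) = 0) :
    interiorProd X (futureForm Up ιE θE u) = 0 := by
  by_cases hu : u ∈ Up
  · rw [futureForm_of_mem hu]
    refine (interiorProd_compContinuousLinearMap _ _ _).trans ?_
    rw [hX hu]
    exact AlternatingMap.zero_compLinearMap _
  · rw [futureForm_of_notMem hu]
    exact interiorProd_zero_right X

namespace IsKinematicDomain

lemma interiorProd_radialField_futureForm (hE : IsKinematicDomain J U Up ιE)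
    (hor : IsTimeOrientation U Up Um) (hU : IsConicSubbundle U) (θE : DForm J E k)
    (u : TangentBundle (𝓡 n) M) : interiorProd (radialField u) (futureForm Up ιE θE u) = 0 := by
  refine interiorProd_futureForm_eq_zero fun hu => ?_
  rw [hE.mfderivWithin_radialProj_radialField hor hU hu]
  exact interiorProd_zero_left _

variable [IsManifold J ∞ E]

lemma smoothForm_futureForm (hE : IsKinematicDomain J U Up ιE) (hor : IsTimeOrientation U Up Um)
    (hU : IsConicSubbundle U) (hθ : SmoothForm J univ θE) :
    SmoothForm (𝓡 n).tangent U (futureForm Up ιE θE) := by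
  refine smoothForm_of_locally fun u hu => ?_
  by_cases huUp : u ∈ Up
  · exact ⟨Up, hor.future_mem_nhdsWithin huUp, (smoothForm_pullbackForm
      (hor.uniqueMDiffOn_future hU) (hE.contMDiffOn_radialProj hor hU) hθ).congr
        fun z hz => futureForm_of_mem hz⟩
  · exact ⟨Upᶜ, hor.compl_future_mem_nhdsWithin hu huUp, (smoothForm_zero Upᶜ k).congr
      fun z hz => futureForm_of_notMem hz⟩

lemma extD_futureForm (hE : IsKinematicDomain J U Up ιE) (hor : IsTimeOrientation U Up Um)
    (hU : IsConicSubbundle U) (hθ : SmoothForm J univ θE) (hclosed : ∀ v, extD J univ θE v = 0)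
    (hu : u ∈ U) : extD (𝓡 n).tangent U (futureForm Up ιE θE) u = 0 := by
  by_cases huUp : u ∈ Up
  · calc extD (𝓡 n).tangent U (futureForm Up ιE θE) u
        = extD (𝓡 n).tangent Up (futureForm Up ιE θE) u :=
          extD_congr_set (hor.eventuallyEq_future huUp)
      _ = extD (𝓡 n).tangent Up (pullbackForm (𝓡 n).tangent Up (radialProj ιE) θE) u :=
          extD_congr huUp (eventually_mem_nhdsWithin.mono fun _ hz => futureForm_of_mem hz)
      _ = pullbackForm (𝓡 n).tangent Up (radialProj ιE) (extD J univ θE) u :=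
          extD_pullbackForm (hor.uniqueMDiffOn_future hU) (hE.contMDiffOn_radialProj hor hU) hθ
            huUp (hor.future_subset_closure_interior hU huUp)
      _ = 0 := by
          rw [pullbackForm, hclosed]
          rfl
  · calc extD (𝓡 n).tangent U (futureForm Up ιE θE) u
        = extD (𝓡 n).tangent U (fun _ => 0) u := extD_congr hu
          (Filter.mem_of_superset (hor.compl_future_mem_nhdsWithin hu huUp)
            fun _ hz => futureForm_of_notMem hz)
      _ = 0 := extD_zero U k u

lemma interiorProd_extension_futureForm [T2Space M] (hE : IsKinematicDomain J U Up ιE)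
    (hor : IsTimeOrientation U Up Um) (hU : IsConicSubbundle U) {WE : VField J E}
    {W : VField (𝓡 n).tangent (TangentBundle (𝓡 n) M)} (hW : IsExtension U ιE WE W)
    (hθ : ∀ v, interiorProd (WE v) (θE v) = 0) (u : TangentBundle (𝓡 n) M) :
    interiorProd (W u) (futureForm Up ιE θE u) = 0 := by
  refine interiorProd_futureForm_eq_zero fun hu => ?_
  obtain ⟨v, t, ht, rfl⟩ := hE.exists_pos_scale hor hU hu
  rw [hE.radialProj_scale hor hU v ht]
  exact (congrArg (interiorProd · (θE v))
    (hE.mfderivWithin_radialProj_extension hor hU hW v ht)).trans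
      (by rw [interiorProd_smul_left, hθ, smul_zero])

end IsKinematicDomain

end FutureForm

section Bivector

variable {n : ℕ} {M : Type*} [TopologicalSpace M]
  [ChartedSpace (EuclideanSpace ℝ (Fin n)) M] [IsManifold (𝓡 n) ∞ M]
  {U : Set (TangentBundle (𝓡 n) M)}

lemma IsVlasovField.isVlasovBivector_wedge {W : VField (𝓡 n).tangent (TangentBundle (𝓡 n) M)}
    (hW : IsVlasovField U W) : IsVlasovBivector U (wedge radialField W) :=
  ⟨⟨radialField, W, smoothField_radialField U, hW.smooth, fun _ _ => rfl⟩,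
    W, hW, fun _ _ => rfl⟩

lemma nullCondition_wedge {k : ℕ} {α : DForm (𝓡 n).tangent (TangentBundle (𝓡 n) M) k}
    {X Y : VField (𝓡 n).tangent (TangentBundle (𝓡 n) M)}
    (hXY : ∀ u ∈ U, LinearIndependent ℝ ![X u, Y u])
    (hX : ∀ u ∈ U, interiorProd (X u) (α u) = 0) (hY : ∀ u ∈ U, interiorProd (Y u) (α u) = 0) :
    NullCondition U (wedge X Y) α := by
  rintro X' Y' ⟨-, -, hwedge⟩ u hu
  exact ⟨interiorProd_eq_zero_of_mem_span (hX u hu) (hY u hu)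
      (left_mem_span_of_ιMulti_eq (hXY u hu) (hwedge u hu)),
    interiorProd_eq_zero_of_mem_span (hX u hu) (hY u hu)
      (right_mem_span_of_ιMulti_eq (hXY u hu) (hwedge u hu))⟩

end Bivector

end

end Vlasov

theorem mainTheorem6_general {n : ℕ} {M : Type*} [TopologicalSpace M] [T2Space M]
    [ChartedSpace (EuclideanSpace ℝ (Fin n)) M] [IsManifold (𝓡 n) ∞ M]
    {H : Type*} [TopologicalSpace H]
    {J : ModelWithCorners ℝ (EuclideanSpace ℝ (Fin (2 * n - 1))) H}
    {E : Type*} [TopologicalSpace E] [ChartedSpace H E] [IsManifold J ∞ E] [Nonempty E]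
    {U Up Um : Set (TangentBundle (𝓡 n) M)}
    (hU : Vlasov.IsConicSubbundle U) (hor : Vlasov.IsTimeOrientation U Up Um)
    {ιE : E → TangentBundle (𝓡 n) M} (hE : Vlasov.IsKinematicDomain J U Up ιE)
    {WE : Vlasov.VField J E} {k : ℕ} {θE : Vlasov.DForm J E k}
    (hsmooth : Vlasov.SmoothForm J univ θE) (hclosed : ∀ v, Vlasov.extD J univ θE v = 0)
    (htangent : ∀ v, Vlasov.interiorProd (WE v) (θE v) = 0)
    {W : Vlasov.VField (𝓡 n).tangent (TangentBundle (𝓡 n) M)}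
    (hW : Vlasov.IsExtension U ιE WE W) :
    Vlasov.IsVlasovBivector U (Vlasov.wedge Vlasov.radialField W) ∧
      Vlasov.SmoothForm (𝓡 n).tangent U (Vlasov.futureForm Up ιE θE) ∧
      Vlasov.NullCondition U (Vlasov.wedge Vlasov.radialField W) (Vlasov.futureForm Up ιE θE) ∧
      ∀ u ∈ U, Vlasov.extD (𝓡 n).tangent U (Vlasov.futureForm Up ιE θE) u = 0 := by
  refine ⟨hW.vlasov.isVlasovBivector_wedge, hE.smoothForm_futureForm hor hU hsmooth, ?_,
    fun u hu => hE.extD_futureForm hor hU hsmooth hclosed hu⟩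
  exact Vlasov.nullCondition_wedge
    (fun u hu => Vlasov.linearIndependent_radialField (hU.slit u hu) (hW.vlasov.horizontal u hu))
    (fun u _ => hE.interiorProd_radialField_futureForm hor hU θE u)
    (fun u _ => hE.interiorProd_extension_futureForm hor hU hW htangent u)

theorem mainTheorem6 {n : ℕ} {M : Type*} [TopologicalSpace M] [T2Space M]
    [SecondCountableTopology M] [ConnectedSpace M]
    [ChartedSpace (EuclideanSpace ℝ (Fin n)) M] [IsManifold (𝓡 n) ∞ M]
    {H : Type*} [TopologicalSpace H]
    (J : ModelWithCorners ℝ (EuclideanSpace ℝ (Fin (2 * n - 1))) H)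
    {E : Type*} [TopologicalSpace E] [ChartedSpace H E] [IsManifold J ∞ E] [Nonempty E]
    (U Up Um : Set (TangentBundle (𝓡 n) M))
    (hU : Vlasov.IsConicSubbundle U) (hor : Vlasov.IsTimeOrientation U Up Um)
    (ιE : E → TangentBundle (𝓡 n) M) (hE : Vlasov.IsKinematicDomain J U Up ιE)
    (WE : Vlasov.VField J E) (hWE : Vlasov.IsVlasovFieldOnE ιE WE)
    (θE : Vlasov.DForm J E (2 * n - 2)) (hθE : Vlasov.TransportOnE WE θE)
    (W : Vlasov.VField (𝓡 n).tangent (TangentBundle (𝓡 n) M))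
    (hW : Vlasov.IsExtension U ιE WE W) :
    Vlasov.TransportOnU U (Vlasov.wedge Vlasov.radialField W) (Vlasov.futureForm Up ιE θE) :=
  have ⟨hvlasov, hsmooth, hnull, hclosed⟩ :=
    mainTheorem6_general hU hor hE hθE.smooth hθE.closed hθE.tangent hW
  ⟨hvlasov, hsmooth, hnull, hclosed⟩
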